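/- Let $G$ be a second-countable, locally compact (Hausdorff), unimodular, amenable group with Haar measure $\mu$, and fix a compact symmetric neighborhood $Q$ of the identity. Here $G$ is amenable if it admits a Følner sequence, i.e. a sequence $(K_n)$ of compact sets with $\mu(K_n)>0$ and $\mu(K_nC\,\Delta\,K_n)/\mu(K_n)\to 0$ for every non-empty compact $C\subseteq G$; the sequence is strong Følner if moreover $\mu(K_nC\cap K_n^cC)/\mu(K_n)\to 0$ for every compact $C\subseteq G$. Let $(\pi,\mathcal H_\pi)$ be a discrete series representation of $G$: a strongly measurable map $\pi$ from $G$ to the unitary operators of a complex Hilbert space with $\pi(xy)=\sigma(x,y)\pi(x)\pi(y)$ for some $\sigma:G\times G\to\mathbb T$, having no closed invariant subspaces except $\{0\}$ and $\mathcal H_\pi$, and such that $\int_G|\langle g,\pi(x)g\rangle|^2\,d\mu(x)<\infty$ for some $g\neq0$. Its formal degree is the number $d_\pi>0$ with $$\int_G\langle f_1,\pi(x)g_1\rangle\langle\pi(x)g_2,f_2\rangle\,d\mu(x)=d_\pi^{-1}\langle f_1,f_2\rangle\overline{\langle g_1,g_2\rangle}\qquad\text{for all } f_1,f_2,g_1,g_2\in\mathcal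 H_\pi .$$ Let $\mathcal B^2_\pi$ be the set of all $g\in\mathcal H_\pi$ such that $V_gg(x)=\langle g,\pi(x)g\rangle$ is locally essentially bounded and $x\mapsto\operatorname{ess\,sup}_{z\in Q}|V_gg(xz)|$ belongs to $L^2(G)$. For a discrete set $\Lambda\subseteq G$, let $$D^-(\Lambda)=\lim_{n\to\infty}\inf_{x\in G}\frac{\#(\Lambda\cap xK_n)}{\mu(K_n)},\qquad D^+(\Lambda)=\lim_{n\to\infty}\sup_{x\in G}\frac{\#(\Lambda\cap xK_n)}{\mu(K_n)},$$ where $(K_n)$ is any strong Følner sequence. The family $\pi(\Lambda)g=(\pi(\lambda)g)_{\lambda\in\Lambda}$ is a frame if there are $A,B>0$ with $A\|f\|^2\le\sum_{\lambda\in\Lambda}|\langle f,\pi(\lambda)g\rangle|^2\le B\|f\|^2$ for all $f\in\mathcal H_\pi$, and a Riesz basis if it is a frame that ceases to be a frame after the removal of an arbitrary element. Let $\Lambda\subseteq G$ be discrete and $g\in\mathcal B^2_\pi$. If $\pi(\Lambda)g$ is a frame for $\mathcal H_\pi$, then the limit $D^-(\Lambda)$ exists, does not depend on the strong Følner sequence,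 and satisfies $D^-(\Lambda)\ge d_\pi$. If $\pi(\Lambda)g$ is a Riesz basis for $\mathcal H_\pi$, then the limit $D^+(\Lambda)$ exists for every strong Følner sequence, and $D^+(\Lambda)=d_\pi$. -/

import Mathlib

open Filter Topology MeasureTheory
open scoped ENNReal Pointwise

noncomputable section

namespace CoherentFrames

section Group

variable {G : Type*} [Group G] [TopologicalSpace G] [MeasurableSpace G]

/-- A (right) Følner sequence of non-null compact sets. The test sets `C` are non-empty
(for `C = ∅` the quotient would be constantly `1`). -/
structure IsFolner (μ : Measure G) (K : ℕ → Set G) : Prop where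
  isCompact : ∀ n, IsCompact (K n)
  measure_ne_zero : ∀ n, μ (K n) ≠ 0
  tendsto_symmDiff : ∀ C : Set G, IsCompact C → C.Nonempty →
    Tendsto (fun n => μ (symmDiff (K n * C) (K n)) / μ (K n)) atTop (𝓝 0)

/-- A (right) strong Følner sequence. -/
structure IsStrongFolner (μ : Measure G) (K : ℕ → Set G) : Prop extends IsFolner μ K where
  tendsto_boundary : ∀ C : Set G, IsCompact C →
    Tendsto (fun n => μ ((K n * C) ∩ ((K n)ᶜ * C)) / μ (K n)) atTop (𝓝 0)

/-- Amenability: existence of a Følner sequence. -/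
def IsAmenable (μ : Measure G) : Prop :=
  ∃ K : ℕ → Set G, IsFolner μ K

/-- The quotient `#(Λ ∩ x K) / μ(K)`. -/
def countRatio (μ : Measure G) (Λ K : Set G) (x : G) : ℝ≥0∞ :=
  ((Λ ∩ x • K).encard : ℝ≥0∞) / μ K

/-- `D` is the lower Beurling density of `Λ`: along every strong Følner sequence the limit
defining the density exists, and it equals `D`. -/
def HasLowerBeurlingDensity (μ : Measure G) (Λ : Set G) (D : ℝ≥0∞) : Prop :=
  ∀ K : ℕ → Set G, IsStrongFolner μ K →
    Tendsto (fun n => ⨅ x : G, countRatio μ Λ (K n) x) atTop (𝓝 D)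

/-- `D` is the upper Beurling density of `Λ`: along every strong Følner sequence the limit
defining the density exists, and it equals `D`. -/
def HasUpperBeurlingDensity (μ : Measure G) (Λ : Set G) (D : ℝ≥0∞) : Prop :=
  ∀ K : ℕ → Set G, IsStrongFolner μ K →
    Tendsto (fun n => ⨆ x : G, countRatio μ Λ (K n) x) atTop (𝓝 D)

/-- The left-sided local maximal function `x ↦ ess sup_{z ∈ Q} |F (x z)|`. -/
def localMaximal (μ : Measure G) (Q : Set G) (F : G → ℂ) (x : G) : ℝ≥0∞ :=
  essSup (fun z => ‖F (x * z)‖ₑ) (μ.restrict Q)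

/-- Membership in the left-sided Wiener amalgam space `W^L(L^p)`: `F` is measurable and locally
essentially bounded, and its local maximal function is in `L^p`. -/
structure MemWienerAmalgam (μ : Measure G) (Q : Set G) (p : ℝ≥0∞) (F : G → ℂ) : Prop where
  aestronglyMeasurable : AEStronglyMeasurable F μ
  locallyBounded : ∀ C : Set G, IsCompact C → essSup (fun x => ‖F x‖ₑ) (μ.restrict C) < ∞
  memLp : MemLp (localMaximal μ Q F) p μ

end Group

section Frames

variable {H : Type*} [NormedAddCommGroup H] [InnerProductSpace ℂ H] {ι : Type*}

/-- The frame inequalities for a family of vectors in a Hilbert space. -/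
def IsFrame (φ : ι → H) : Prop :=
  ∃ A B : ℝ, 0 < A ∧ 0 < B ∧ ∀ f : H,
    Summable (fun i => ‖inner ℂ (φ i) f‖ ^ 2) ∧
    A * ‖f‖ ^ 2 ≤ ∑' i, ‖inner ℂ (φ i) f‖ ^ 2 ∧
    ∑' i, ‖inner ℂ (φ i) f‖ ^ 2 ≤ B * ‖f‖ ^ 2

/-- A Riesz basis, i.e. an exact frame: a frame that ceases to be a frame after the removal of
an arbitrary element. -/
def IsRieszBasis (φ : ι → H) : Prop :=
  IsFrame φ ∧ ∀ j : ι, ¬ IsFrame (fun i : {i : ι // i ≠ j} => φ i)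

end Frames

section Representations

variable {G : Type*} [Group G] [TopologicalSpace G] [MeasurableSpace G]
variable {H : Type*} [NormedAddCommGroup H] [InnerProductSpace ℂ H]

/-- A projective unitary representation: a strongly measurable map into the unitary operators
that is multiplicative up to a phase. -/
structure IsProjectiveRep (π : G → H ≃ₗᵢ[ℂ] H) : Prop where
  stronglyMeasurable : ∀ f : H, StronglyMeasurable (fun x => π x f)
  exists_cocycle : ∃ σ : G → G → Circle, ∀ (x y : G) (f : H),
    π (x * y) f = (σ x y : ℂ) • π x (π y f)

/-- The coefficient `V_g f (x) = ⟨f, π(x) g⟩`. Mathlib's inner product is linear in the second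
argument, so the inner product `⟨u, v⟩` that is linear in `u` is `inner ℂ v u`. -/
def coeff (π : G → H ≃ₗᵢ[ℂ] H) (g f : H) (x : G) : ℂ :=
  inner ℂ (π x g) f

/-- Irreducibility: there are no non-trivial closed invariant subspaces. -/
def IsIrreducible (π : G → H ≃ₗᵢ[ℂ] H) : Prop :=
  ∀ W : Submodule ℂ H, IsClosed (W : Set H) → (∀ x : G, ∀ f ∈ W, π x f ∈ W) → W = ⊥ ∨ W = ⊤

/-- A discrete series representation: a projective unitary representation that is irreducible
and square-integrable. -/
structure IsDiscreteSeries (μ : Measure G) (π : G → H ≃ₗᵢ[ℂ] H) : Prop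
    extends IsProjectiveRep π where
  irreducible : IsIrreducible π
  squareIntegrable : ∃ g : H, g ≠ 0 ∧ ∫⁻ x, ‖coeff π g g x‖ₑ ^ 2 ∂μ < ∞

/-- `d` is the formal degree of `π`: the positive number in the orthogonality relations
`∫ ⟨f₁, π(x) g₁⟩ ⟨π(x) g₂, f₂⟩ dμ(x) = d⁻¹ ⟨f₁, f₂⟩ conj ⟨g₁, g₂⟩`. -/
def IsFormalDegree (μ : Measure G) (π : G → H ≃ₗᵢ[ℂ] H) (d : ℝ) : Prop :=
  0 < d ∧ ∀ f₁ f₂ g₁ g₂ : H,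
    Integrable (fun x => coeff π g₁ f₁ x * inner ℂ f₂ (π x g₂)) μ ∧
    ∫ x, coeff π g₁ f₁ x * inner ℂ f₂ (π x g₂) ∂μ =
      (d : ℂ)⁻¹ * inner ℂ f₂ f₁ * (starRingEnd ℂ) (inner ℂ g₂ g₁)

/-- The space `B^2_π` of all `g` with `V_g g ∈ W^L(L^2)`. -/
def B2 (μ : Measure G) (Q : Set G) (π : G → H ≃ₗᵢ[ℂ] H) : Set H :=
  {g | MemWienerAmalgam μ Q 2 (coeff π g g)}

/-- The coherent system `(π(l) g)_{l ∈ Λ}`. -/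
def coherentSystem (π : G → H ≃ₗᵢ[ℂ] H) (Λ : Set G) (g : H) : Λ → H :=
  fun l => π l g

end Representations

end CoherentFrames

end

/-
For a finite-dimensional subspace `W` with orthogonal projection `P`, the orthogonality relations
give the trace formula `∫ ‖P (π y g)‖² dμ(y) = dim W * ‖g‖² / d`. If `π(Λ) g` is a frame, the
dual frame vectors indexed by `Λ ∩ x K C` span a space `W` of dimension at most `#(Λ ∩ x K C)`.
For `y ∈ x K` the distance from `π y g` to `W` is controlled by the coefficients `⟨π l g, π y g⟩`
with `l ∉ y C`, which are small in `ℓ²` because `g ∈ B²_π`. Hence `‖P (π y g)‖ ≈ ‖g‖` on `x K` and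
`#(Λ ∩ x K C) / d` is at least almost `μ K`. If `π(Λ) g` is a Riesz basis, the vectors `π l g` with
`l ∈ Λ ∩ x K` are independent, and the projection of `π y g` to their span is small for
`y ∉ x K C`, so `#(Λ ∩ x K) / d` is at most about `μ (K C)`. Along a Følner sequence the passage
from `K` to `K C` is negligible. A frame forces `Λ` to be relatively separated, so along strong
Følner sequences the boundary of `K` contains few points of `Λ`, and the lower densities converge.
-/

namespace CoherentFrames

section ProjectiveRepresentations

variable {G : Type*} [Group G] [MeasurableSpace G]
variable {H : Type*} [NormedAddCommGroup H] [InnerProductSpace ℂ H]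
variable {π : G → H ≃ₗᵢ[ℂ] H}

namespace IsProjectiveRep

lemma exists_apply_one (hπ : IsProjectiveRep π) : ∃ c : Circle, ∀ f, π 1 f = (c : ℂ) • f := by
  obtain ⟨σ, hσ⟩ := hπ.exists_cocycle
  refine ⟨(σ 1 1)⁻¹, fun f => ?_⟩
  have h : f = (σ 1 1 : ℂ) • π 1 f :=
    (π 1).injective (by simpa only [mul_one, map_smul] using hσ 1 1 f)
  rw [← Circle.smul_def, eq_inv_smul_iff, Circle.smul_def, ← h]

lemma exists_coeff_mul (hπ : IsProjectiveRep π) :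
    ∃ τ : G → G → Circle, ∀ g f x y, coeff π g (π x f) (x * y) = τ x y * coeff π g f y := by
  obtain ⟨σ, hσ⟩ := hπ.exists_cocycle
  refine ⟨fun x y => (σ x y)⁻¹, fun g f x y => ?_⟩
  rw [coeff, hσ, inner_smul_left, LinearIsometryEquiv.inner_map_map, Circle.coe_inv_eq_conj, coeff]

lemma exists_coeff_inv (hπ : IsProjectiveRep π) :
    ∃ θ : G → Circle, ∀ g f x, coeff π g f x⁻¹ = θ x * starRingEnd ℂ (coeff π f g x) := by
  obtain ⟨c, hc⟩ := hπ.exists_apply_one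
  obtain ⟨τ, hτ⟩ := hπ.exists_coeff_mul
  refine ⟨fun x => (τ x x⁻¹)⁻¹ * c⁻¹, fun g f x => ?_⟩
  have h := hτ g f x x⁻¹
  rw [mul_inv_cancel, coeff, hc, inner_smul_left, ← Circle.coe_inv_eq_conj] at h
  calc coeff π g f x⁻¹ = ((τ x x⁻¹)⁻¹ : Circle) * (τ x x⁻¹ * coeff π g f x⁻¹) := by
        rw [← mul_assoc, ← Circle.coe_mul, inv_mul_cancel, Circle.coe_one, one_mul]
    _ = ((τ x x⁻¹)⁻¹ * c⁻¹ : Circle) * starRingEnd ℂ (coeff π f g x) := by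
        rw [← h, Circle.coe_mul, mul_assoc, coeff, inner_conj_symm]

lemma norm_coeff_apply (hπ : IsProjectiveRep π) (g f : H) (y x : G) :
    ‖coeff π g (π y f) x‖ = ‖coeff π g f (y⁻¹ * x)‖ := by
  obtain ⟨τ, hτ⟩ := hπ.exists_coeff_mul
  rw [← mul_inv_cancel_left y x, hτ, norm_mul, Circle.norm_coe, one_mul, inv_mul_cancel_left]

lemma inner_coeff_apply (hπ : IsProjectiveRep π) (g₁ g₂ f₁ f₂ : H) (y x : G) :
    inner ℂ (coeff π g₂ (π y f₂) x) (coeff π g₁ (π y f₁) x) =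
      inner ℂ (coeff π g₂ f₂ (y⁻¹ * x)) (coeff π g₁ f₁ (y⁻¹ * x)) := by
  obtain ⟨τ, hτ⟩ := hπ.exists_coeff_mul
  rw [← mul_inv_cancel_left y x, hτ, hτ, inv_mul_cancel_left]
  simp only [RCLike.inner_apply, map_mul]
  rw [mul_mul_mul_comm, Complex.mul_conj', Circle.norm_coe, Complex.ofReal_one, one_pow, one_mul]

lemma norm_coeff_inv (hπ : IsProjectiveRep π) (g f : H) (x : G) :
    ‖coeff π g f x⁻¹‖ = ‖coeff π f g x‖ := by
  obtain ⟨θ, hθ⟩ := hπ.exists_coeff_inv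
  rw [hθ, norm_mul, Circle.norm_coe, one_mul, RCLike.norm_conj]

lemma inner_coeff_inv (hπ : IsProjectiveRep π) (g₁ g₂ f₁ f₂ : H) (x : G) :
    inner ℂ (coeff π g₂ f₂ x⁻¹) (coeff π g₁ f₁ x⁻¹) =
      inner ℂ (coeff π f₁ g₁ x) (coeff π f₂ g₂ x) := by
  obtain ⟨θ, hθ⟩ := hπ.exists_coeff_inv
  rw [hθ, hθ]
  simp only [RCLike.inner_apply, map_mul, Complex.conj_conj]
  rw [mul_mul_mul_comm, Complex.mul_conj', Circle.norm_coe, Complex.ofReal_one, one_pow, one_mul,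
    mul_comm]

lemma norm_coeff_one (hπ : IsProjectiveRep π) (g f : H) : ‖coeff π g f 1‖ = ‖inner ℂ g f‖ := by
  obtain ⟨c, hc⟩ := hπ.exists_apply_one
  rw [coeff, hc, inner_smul_left, norm_mul, RCLike.norm_conj, Circle.norm_coe, one_mul]

lemma stronglyMeasurable_coeff (hπ : IsProjectiveRep π) (g f : H) :
    StronglyMeasurable (coeff π g f) :=
  (hπ.stronglyMeasurable g).inner stronglyMeasurable_const

end IsProjectiveRep

end ProjectiveRepresentations

section Continuity

variable {G : Type*} [Group G] [TopologicalSpace G] [IsTopologicalGroup G]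
  [LocallyCompactSpace G] [SecondCountableTopology G] [MeasurableSpace G] [BorelSpace G]

lemma isInvInvariant_of_isMulRightInvariant (μ : Measure G)
    [μ.IsHaarMeasure] [μ.IsMulRightInvariant] : μ.IsInvInvariant := by
  obtain ⟨K, hK, hK1⟩ := exists_compact_mem_nhds (1 : G)
  have h : μ.inv = μ.inv.haarScalarFactor μ • μ := Measure.isMulLeftInvariant_eq_smul _ _
  have hpos : μ (K ∪ K⁻¹) ≠ 0 :=
    (Measure.measure_pos_of_mem_nhds μ (mem_of_superset hK1 Set.subset_union_left)).ne'
  have hscale : (μ.inv.haarScalarFactor μ : ℝ≥0∞) * μ (K ∪ K⁻¹) = 1 * μ (K ∪ K⁻¹) := by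
    have := congrArg (fun ν : Measure G => ν (K ∪ K⁻¹)) h
    simpa [Measure.inv_apply, Set.union_comm] using this.symm
  have hone : μ.inv.haarScalarFactor μ = 1 := by
    exact_mod_cast (ENNReal.mul_left_inj hpos (hK.union hK.inv).measure_ne_top).1 hscale
  exact ⟨by rw [h, hone, one_smul]⟩

variable {H : Type*} [NormedAddCommGroup H] [InnerProductSpace ℂ H] {π : G → H ≃ₗᵢ[ℂ] H}

/- Steinhaus' theorem: some set of `x` on which `π x⁻¹ g` is almost constant has positive Haar
measure, so its quotients `x / y` fill a neighborhood of the identity. -/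
lemma IsProjectiveRep.eventually_norm_sub_smul_lt (hπ : IsProjectiveRep π) (g : H) {ε : ℝ}
    (hε : 0 < ε) : ∀ᶠ u in 𝓝 (1 : G), ∃ c : Circle, ‖π u g - (c : ℂ) • g‖ < ε := by
  have hmeas : StronglyMeasurable fun x : G => π x⁻¹ g :=
    (hπ.stronglyMeasurable g).comp_measurable measurable_inv
  obtain ⟨t, ht_countable, ht⟩ := hmeas.isSeparable_range
  let E (v : H) : Set G := {x | ‖π x⁻¹ g - v‖ < ε / 2}
  have hE_meas (v : H) : MeasurableSet (E v) :=
    (hmeas.sub stronglyMeasurable_const).norm.measurable measurableSet_Iio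
  have hE_cover : ⋃ v ∈ t, E v = Set.univ := Set.eq_univ_of_forall fun x => by
    obtain ⟨v, hv, hxv⟩ := Metric.mem_closure_iff.1 (ht ⟨x, rfl⟩) (ε / 2) (half_pos hε)
    exact Set.mem_biUnion hv (by rwa [dist_eq_norm] at hxv)
  obtain ⟨v, -, hv⟩ : ∃ v ∈ t, 0 < Measure.haar (E v) := by
    by_contra! hnull
    refine NeZero.ne (Measure.haar : Measure G) (Measure.measure_univ_eq_zero.1 ?_)
    rw [← hE_cover, measure_biUnion_null_iff ht_countable]
    exact fun v hv => le_antisymm (hnull v hv) zero_le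
  obtain ⟨σ, hσ⟩ := hπ.exists_cocycle
  filter_upwards [Measure.div_mem_nhds_one_of_haar_pos _ _ (hE_meas v) hv]
  rintro _ ⟨x, hx, y, hy, rfl⟩
  refine ⟨(σ x⁻¹ (x / y))⁻¹, ?_⟩
  have hphase : π x⁻¹ (π (x / y) g) = ((σ x⁻¹ (x / y))⁻¹ : Circle) • π y⁻¹ g := by
    rw [eq_inv_smul_iff, Circle.smul_def, ← hσ, div_eq_mul_inv, inv_mul_cancel_left]
  have hdiff : π x⁻¹ (π (x / y) g - ((σ x⁻¹ (x / y))⁻¹ : Circle) • g) =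
      ((σ x⁻¹ (x / y))⁻¹ : Circle) • ((π y⁻¹ g - v) - (π x⁻¹ g - v)) := by
    rw [map_sub, hphase, sub_sub_sub_cancel_right, smul_sub, Circle.smul_def, Circle.smul_def,
      Circle.smul_def, map_smul]
  calc ‖π (x / y) g - ((σ x⁻¹ (x / y))⁻¹ : Circle) • g‖
      = ‖(π y⁻¹ g - v) - (π x⁻¹ g - v)‖ := by
        rw [← (π x⁻¹).norm_map, hdiff, Circle.smul_def, norm_smul, Circle.norm_coe, one_mul]
    _ ≤ ‖π y⁻¹ g - v‖ + ‖π x⁻¹ g - v‖ := norm_sub_le _ _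
    _ < ε / 2 + ε / 2 := add_lt_add hy hx
    _ = ε := add_halves ε

lemma IsProjectiveRep.continuous_norm_coeff (hπ : IsProjectiveRep π) (g f : H) :
    Continuous fun x => ‖coeff π g f x‖ := by
  have hone (f : H) : ContinuousAt (fun x => ‖coeff π g f x‖) 1 := by
    refine Metric.tendsto_nhds.2 fun ε hε => ?_
    filter_upwards [hπ.eventually_norm_sub_smul_lt g (show 0 < ε / (‖f‖ + 1) by positivity)]
    rintro u ⟨c, hc⟩
    have hphase : ‖coeff π g f 1‖ = ‖inner ℂ ((c : ℂ) • g) f‖ := by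
      rw [hπ.norm_coeff_one, inner_smul_left, norm_mul, RCLike.norm_conj, Circle.norm_coe, one_mul]
    rw [hphase, Real.dist_eq]
    calc |‖coeff π g f u‖ - ‖inner ℂ ((c : ℂ) • g) f‖|
        ≤ ‖coeff π g f u - inner ℂ ((c : ℂ) • g) f‖ := abs_norm_sub_norm_le _ _
      _ = ‖inner ℂ (π u g - (c : ℂ) • g) f‖ := by rw [inner_sub_left, coeff]
      _ ≤ ‖π u g - (c : ℂ) • g‖ * ‖f‖ := norm_inner_le_norm _ _
      _ ≤ ε / (‖f‖ + 1) * ‖f‖ := by gcongr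
      _ < ε := by
        rw [div_mul_eq_mul_div, div_lt_iff₀ (by positivity)]
        exact mul_lt_mul_of_pos_left (lt_add_one _) hε
  refine continuous_iff_continuousAt.2 fun y => ?_
  obtain ⟨f, rfl⟩ := (π y).surjective f
  simp only [hπ.norm_coeff_apply g f y]
  have htranslate : ContinuousAt (fun x => y⁻¹ * x) y := by fun_prop
  exact (hone f).comp_of_eq htranslate (inv_mul_cancel y)

end Continuity

section Schur

variable {G : Type*} {H : Type*} [NormedAddCommGroup H] [InnerProductSpace ℂ H] [CompleteSpace H]
  {π : G → H ≃ₗᵢ[ℂ] H}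

/- The positive part of `T` commutes with `π`, so its kernel is trivial or everything, and the
negative part maps into that kernel. -/
lemma IsIrreducible.nonneg_or_nonpos (hπ : IsIrreducible π) {T : H →L[ℂ] H}
    (hT : IsSelfAdjoint T) (hcomm : ∀ x f, T (π x f) = π x (T f)) : 0 ≤ T ∨ T ≤ 0 := by
  have hcomm' (x : G) (f : H) : T⁺ (π x f) = π x (T⁺ f) := by
    have : Commute T ((π x).toContinuousLinearEquiv : H →L[ℂ] H) :=
      ContinuousLinearMap.ext (hcomm x)
    exact congrArg (· f) (this.cfcₙ_real _).eq
  have hinvariant (x : G) (f : H) (hf : f ∈ T⁺.ker) : π x f ∈ T⁺.ker :=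
    (hcomm' x f).trans (((π x).congr_arg hf).trans (map_zero _))
  rcases hπ T⁺.ker T⁺.isClosed_ker hinvariant with hker | hker
  · left
    have hneg : T⁻ = 0 := ContinuousLinearMap.ext fun f => by
      have : T⁻ f ∈ T⁺.ker :=
        congrArg (fun S : H →L[ℂ] H => S f) (CFC.posPart_mul_negPart T)
      rwa [hker] at this
    rw [← CFC.posPart_sub_negPart T, hneg, sub_zero]
    exact CFC.posPart_nonneg T
  · right
    have hpos : T⁺ = 0 := ContinuousLinearMap.ext fun f => by
      have : f ∈ T⁺.ker := by rw [hker]; trivial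
      exact this
    rw [← CFC.posPart_sub_negPart T, hpos, zero_sub, neg_nonpos]
    exact CFC.negPart_nonneg T

lemma IsIrreducible.exists_eq_smul_of_isSelfAdjoint (hπ : IsIrreducible π) {T : H →L[ℂ] H}
    (hT : IsSelfAdjoint T) (hcomm : ∀ x f, T (π x f) = π x (T f)) :
    ∃ t : ℝ, ∀ f, T f = (t : ℂ) • f := by
  have hspectrum : (spectrum ℝ T).Subsingleton := by
    intro a ha b hb
    by_contra! hne
    wlog hlt : a < b generalizing a b
    · exact this hb ha hne.symm (hne.lt_or_gt.resolve_left hlt)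
    have hmid := hπ.nonneg_or_nonpos (T := T - algebraMap ℝ _ ((a + b) / 2))
      (hT.sub (.algebraMap _ (.all _))) (fun x f => by
        simp [Algebra.algebraMap_eq_smul_one, hcomm, map_real_smul (π x) (π x).continuous])
    rw [sub_nonneg, sub_nonpos, algebraMap_le_iff_le_spectrum,
      le_algebraMap_iff_spectrum_le] at hmid
    rcases hmid with h | h
    · linarith [h a ha]
    · linarith [h b hb]
  obtain ⟨t, ht⟩ : ∃ t, spectrum ℝ T ⊆ {t} := by
    rcases hspectrum.eq_empty_or_singleton with h | ⟨t, h⟩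
    · exact ⟨0, by simp [h]⟩
    · exact ⟨t, h.subset⟩
  refine ⟨t, fun f => ?_⟩
  rw [CFC.eq_algebraMap_of_spectrum_subset_singleton T t ht hT]
  simp [Algebra.algebraMap_eq_smul_one]

lemma IsIrreducible.exists_eq_smul (hπ : IsIrreducible π) {T : H →L[ℂ] H}
    (hcomm : ∀ x f, T (π x f) = π x (T f)) : ∃ c : ℂ, ∀ f, T f = c • f := by
  have hadj (x : G) (f : H) : star T (π x f) = π x (star T f) := by
    refine ext_inner_right ℂ fun v => ?_
    obtain ⟨w, rfl⟩ := (π x).surjective v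
    rw [ContinuousLinearMap.star_eq_adjoint, ContinuousLinearMap.adjoint_inner_left, hcomm,
      LinearIsometryEquiv.inner_map_map, LinearIsometryEquiv.inner_map_map,
      ContinuousLinearMap.adjoint_inner_left]
  obtain ⟨a, ha⟩ := hπ.exists_eq_smul_of_isSelfAdjoint (realPart T).2
    (fun x f => by
      simp [realPart_apply_coe, hcomm, hadj, map_real_smul (π x) (π x).continuous])
  obtain ⟨b, hb⟩ := hπ.exists_eq_smul_of_isSelfAdjoint (imaginaryPart T).2
    (fun x f => by
      simp [imaginaryPart_apply_coe, hcomm, hadj, map_real_smul (π x) (π x).continuous])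
  refine ⟨a + Complex.I * b, fun f => ?_⟩
  conv_lhs => rw [← realPart_add_I_smul_imaginaryPart T]
  rw [add_apply, smul_apply, ha, hb, smul_smul, ← add_smul]

end Schur

section Orthogonality

variable {G : Type*} {H : Type*} [NormedAddCommGroup H] [InnerProductSpace ℂ H]
  {π : G → H ≃ₗᵢ[ℂ] H}

lemma coeff_add (g f f' : H) : coeff π g (f + f') = coeff π g f + coeff π g f' :=
  funext fun _ => inner_add_right _ _ _

lemma coeff_smul (g : H) (c : ℂ) (f : H) : coeff π g (c • f) = c • coeff π g f :=
  funext fun _ => inner_smul_right _ _ _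

variable [MeasurableSpace G] {μ : Measure G}

variable (π μ) in
/-- The graph of the coefficient map `f ↦ V_g f`, as an operator from the vectors with
square-integrable coefficient to `L²(G)`. It carries the Hilbert space structure of the graph
norm. -/
noncomputable def coeffGraph (g : H) : Submodule ℂ (WithLp 2 (H × Lp ℂ 2 μ)) where
  carrier := {e | e.snd =ᵐ[μ] coeff π g e.fst}
  zero_mem' := by
    have : coeff π g 0 = 0 := funext fun _ => inner_zero_right _
    simpa [this] using Lp.coeFn_zero ℂ 2 μ
  add_mem' {a b} ha hb := by
    simp only [Set.mem_ofPred_eq, WithLp.add_fst, WithLp.add_snd, coeff_add] at ha hb ⊢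
    exact (Lp.coeFn_add _ _).trans (ha.add hb)
  smul_mem' c a ha := by
    simp only [Set.mem_ofPred_eq, WithLp.smul_fst, WithLp.smul_snd, coeff_smul] at ha ⊢
    exact (Lp.coeFn_smul _ _).trans (ha.const_smul c)

lemma isClosed_coeffGraph (g : H) :
    IsClosed (coeffGraph π μ g : Set (WithLp 2 (H × Lp ℂ 2 μ))) := by
  refine IsSeqClosed.isClosed fun e e₀ he hlim => ?_
  have hfst : Tendsto (fun n => (e n).fst) atTop (𝓝 e₀.fst) :=
    ((WithLp.fstL 2 ℂ H (Lp ℂ 2 μ)).continuous.tendsto e₀).comp hlim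
  have hsnd : Tendsto (fun n => (e n).snd) atTop (𝓝 e₀.snd) :=
    ((WithLp.sndL 2 ℂ H (Lp ℂ 2 μ)).continuous.tendsto e₀).comp hlim
  obtain ⟨ns, hns, hae⟩ := (tendstoInMeasure_of_tendsto_Lp hsnd).exists_seq_tendsto_ae
  change e₀.snd =ᵐ[μ] coeff π g e₀.fst
  filter_upwards [hae, ae_all_iff.2 he] with x hx hcoeff
  simp only [hcoeff] at hx
  exact tendsto_nhds_unique hx (tendsto_const_nhds.inner (hfst.comp hns.tendsto_atTop))

variable (π μ) in
/-- The projection of the graph of `f ↦ V_g f` to the domain. -/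
noncomputable def coeffGraphFst (g : H) : coeffGraph π μ g →L[ℂ] H :=
  WithLp.fstL 2 ℂ H (Lp ℂ 2 μ) ∘L (coeffGraph π μ g).subtypeL

variable (π μ) in
/-- The projection of the graph of `f ↦ V_g f` to the codomain. -/
noncomputable def coeffGraphSnd (g : H) : coeffGraph π μ g →L[ℂ] Lp ℂ 2 μ :=
  WithLp.sndL 2 ℂ H (Lp ℂ 2 μ) ∘L (coeffGraph π μ g).subtypeL

lemma coeffGraphSnd_ae_eq {g : H} (e : coeffGraph π μ g) :
    coeffGraphSnd π μ g e =ᵐ[μ] coeff π g (coeffGraphFst π μ g e) :=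
  e.2

lemma memLp_coeff_coeffGraphFst {g : H} (e : coeffGraph π μ g) :
    MemLp (coeff π g (coeffGraphFst π μ g e)) 2 μ :=
  (memLp_congr_ae (coeffGraphSnd_ae_eq e)).1 (Lp.memLp _)

lemma exists_coeffGraphFst_eq {g f : H} (h : MemLp (coeff π g f) 2 μ) :
    ∃ e, coeffGraphFst π μ g e = f :=
  ⟨⟨WithLp.toLp 2 (f, h.toLp _), h.coeFn_toLp⟩, rfl⟩

lemma inner_coeffGraph {g : H} (e e' : coeffGraph π μ g) :
    inner ℂ e e' = inner ℂ (coeffGraphFst π μ g e) (coeffGraphFst π μ g e') +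
      ∫ x, inner ℂ (coeff π g (coeffGraphFst π μ g e) x)
        (coeff π g (coeffGraphFst π μ g e') x) ∂μ := by
  rw [Submodule.coe_inner, WithLp.prod_inner_apply]
  congr 1
  refine (L2.inner_def _ _).trans (integral_congr_ae ?_)
  filter_upwards [coeffGraphSnd_ae_eq e, coeffGraphSnd_ae_eq e'] with x h h'
  rw [← h, ← h']
  rfl

variable [Group G]

namespace IsProjectiveRep

lemma memLp_coeff_apply_iff [MeasurableMul G] [μ.IsMulLeftInvariant] (hπ : IsProjectiveRep π)
    {p : ℝ≥0∞} {g f : H} (y : G) :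
    MemLp (coeff π g (π y f)) p μ ↔ MemLp (coeff π g f) p μ := by
  have hmeas (f : H) : AEStronglyMeasurable (coeff π g f) μ :=
    (hπ.stronglyMeasurable_coeff g f).aestronglyMeasurable
  have htranslate := measurePreserving_mul_left μ y⁻¹
  rw [memLp_congr_norm (hmeas _) ((hmeas f).comp_measurePreserving htranslate)
    (.of_forall fun x => hπ.norm_coeff_apply g f y x)]
  conv_rhs => rw [← htranslate.map_eq]
  rw [memLp_map_measure_iff (by rw [htranslate.map_eq]; exact hmeas f) htranslate.aemeasurable]

lemma memLp_coeff_comm [MeasurableInv G] [μ.IsInvInvariant] (hπ : IsProjectiveRep π)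
    {p : ℝ≥0∞} {g f : H} (h : MemLp (coeff π g f) p μ) : MemLp (coeff π f g) p μ := by
  refine (h.comp_measurePreserving (Measure.measurePreserving_inv μ)).congr_norm
    (hπ.stronglyMeasurable_coeff f g).aestronglyMeasurable (.of_forall fun x => ?_)
  exact hπ.norm_coeff_inv g f x

end IsProjectiveRep
end Orthogonality

section CoefficientOperator

variable {G : Type*} [Group G] [MeasurableSpace G] [MeasurableMul G] {H : Type*}
  [NormedAddCommGroup H] [InnerProductSpace ℂ H] {π : G → H ≃ₗᵢ[ℂ] H} {μ : Measure G}
  [μ.IsMulLeftInvariant]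

lemma IsProjectiveRep.integral_inner_coeff_apply (hπ : IsProjectiveRep π) (g₁ g₂ f₁ f₂ : H)
    (y : G) :
    ∫ x, inner ℂ (coeff π g₂ (π y f₂) x) (coeff π g₁ (π y f₁) x) ∂μ =
      ∫ x, inner ℂ (coeff π g₂ f₂ x) (coeff π g₁ f₁ x) ∂μ := by
  simp only [hπ.inner_coeff_apply]
  exact integral_mul_left_eq_self (fun x => inner ℂ (coeff π g₂ f₂ x) (coeff π g₁ f₁ x)) y⁻¹

lemma IsProjectiveRep.exists_coeffGraphFst_eq_apply (hπ : IsProjectiveRep π) {g : H}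
    (e : coeffGraph π μ g) (y : G) :
    ∃ e' : coeffGraph π μ g, coeffGraphFst π μ g e' = π y (coeffGraphFst π μ g e) :=
  exists_coeffGraphFst_eq ((hπ.memLp_coeff_apply_iff y).2 (memLp_coeff_coeffGraphFst e))

lemma IsProjectiveRep.exists_apply_eq_coeffGraphFst (hπ : IsProjectiveRep π) {g : H}
    (e : coeffGraph π μ g) (y : G) :
    ∃ e' : coeffGraph π μ g, π y (coeffGraphFst π μ g e') = coeffGraphFst π μ g e := by
  obtain ⟨v, hv⟩ := (π y).surjective (coeffGraphFst π μ g e)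
  have hv_memLp : MemLp (coeff π g (π y v)) 2 μ := by
    rw [hv]
    exact memLp_coeff_coeffGraphFst e
  obtain ⟨e', he'⟩ := exists_coeffGraphFst_eq ((hπ.memLp_coeff_apply_iff y).1 hv_memLp)
  exact ⟨e', by rw [he', hv]⟩

lemma IsProjectiveRep.inner_eq_of_coeffGraphFst_eq_apply (hπ : IsProjectiveRep π) {g : H}
    {e₁ e₂ e₁' e₂' : coeffGraph π μ g} (y : G)
    (h₁ : coeffGraphFst π μ g e₁' = π y (coeffGraphFst π μ g e₁))
    (h₂ : coeffGraphFst π μ g e₂' = π y (coeffGraphFst π μ g e₂)) :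
    inner ℂ e₁' e₂' = inner ℂ e₁ e₂ := by
  refine (inner_coeffGraph e₁' e₂').trans (Eq.trans ?_ (inner_coeffGraph e₁ e₂).symm)
  rw [h₁, h₂, (π y).inner_map_map, hπ.integral_inner_coeff_apply]

variable [CompleteSpace H]

instance (g : H) : CompleteSpace (coeffGraph π μ g) :=
  (isClosed_coeffGraph g).completeSpace_coe

lemma IsProjectiveRep.coeffGraphFst_adjoint_apply (hπ : IsProjectiveRep π) (g f : H) (y : G) :
    coeffGraphFst π μ g ((coeffGraphFst π μ g).adjoint (π y f)) =
      π y (coeffGraphFst π μ g ((coeffGraphFst π μ g).adjoint f)) := by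
  set J := coeffGraphFst π μ g
  obtain ⟨e, he⟩ := hπ.exists_coeffGraphFst_eq_apply (J.adjoint f) y
  suffices J.adjoint (π y f) = e by rw [this, he]
  refine ext_inner_right ℂ fun e' => ?_
  obtain ⟨w, hw⟩ := hπ.exists_apply_eq_coeffGraphFst e' y
  calc inner ℂ (J.adjoint (π y f)) e' = inner ℂ (π y f) (J e') := J.adjoint_inner_left e' _
    _ = inner ℂ f (J w) := by rw [← hw, (π y).inner_map_map]
    _ = inner ℂ (J.adjoint f) w := (J.adjoint_inner_left w f).symm
    _ = inner ℂ e e' := (hπ.inner_eq_of_coeffGraphFst_eq_apply y he hw.symm).symm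

lemma IsProjectiveRep.exists_continuousLinearMap_ae_eq_coeff (hπ : IsProjectiveRep π)
    (hirr : IsIrreducible π) {g f₀ : H} (hf₀ : f₀ ≠ 0) (h : MemLp (coeff π g f₀) 2 μ) :
    ∃ V : H →L[ℂ] Lp ℂ 2 μ, ∀ f, V f =ᵐ[μ] coeff π g f := by
  set J := coeffGraphFst π μ g
  obtain ⟨t, ht⟩ := hirr.exists_eq_smul (T := J ∘L J.adjoint)
    fun y f => hπ.coeffGraphFst_adjoint_apply g f y
  have hJ (f : H) : J (J.adjoint f) = t • f := ht f
  have ht₀ : t ≠ 0 := by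
    rintro rfl
    obtain ⟨e, he⟩ := exists_coeffGraphFst_eq h
    have hadj : J.adjoint f₀ = 0 := by
      rw [← inner_self_eq_zero (𝕜 := ℂ), J.adjoint_inner_left, hJ, zero_smul, inner_zero_right]
    have := J.adjoint_inner_left e f₀
    rw [hadj, inner_zero_left, he, eq_comm, inner_self_eq_zero] at this
    exact hf₀ this
  refine ⟨t⁻¹ • (coeffGraphSnd π μ g ∘L J.adjoint), fun f => ?_⟩
  have hsnd : coeffGraphSnd π μ g (J.adjoint f) =ᵐ[μ] t • coeff π g f := by
    rw [← coeff_smul, ← hJ]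
    exact coeffGraphSnd_ae_eq _
  refine (Lp.coeFn_smul t⁻¹ _).trans ((hsnd.const_smul t⁻¹).trans ?_)
  rw [inv_smul_smul₀ ht₀]

end CoefficientOperator

section FormalDegree

variable {G : Type*} [Group G] [TopologicalSpace G] [IsTopologicalGroup G]
  [MeasurableSpace G] [BorelSpace G] {H : Type*}
  [NormedAddCommGroup H] [InnerProductSpace ℂ H] [CompleteSpace H] {π : G → H ≃ₗᵢ[ℂ] H}
  {μ : Measure G} [μ.IsMulLeftInvariant] [μ.IsInvInvariant]

namespace IsDiscreteSeries

lemma exists_continuousLinearMap_ae_eq_coeff (hπ : IsDiscreteSeries μ π) (g : H) :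
    ∃ V : H →L[ℂ] Lp ℂ 2 μ, ∀ f, V f =ᵐ[μ] coeff π g f := by
  obtain ⟨g₀, hg₀, hint⟩ := hπ.squareIntegrable
  have hmemLp : MemLp (coeff π g₀ g₀) 2 μ := by
    refine ⟨(hπ.stronglyMeasurable_coeff g₀ g₀).aestronglyMeasurable, ?_⟩
    rw [eLpNorm_lt_top_iff_lintegral_rpow_enorm_lt_top two_ne_zero ENNReal.ofNat_ne_top]
    simpa using hint
  obtain ⟨V, hV⟩ :=
    hπ.toIsProjectiveRep.exists_continuousLinearMap_ae_eq_coeff hπ.irreducible hg₀ hmemLp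
  exact hπ.toIsProjectiveRep.exists_continuousLinearMap_ae_eq_coeff hπ.irreducible hg₀
    (hπ.memLp_coeff_comm ((memLp_congr_ae (hV g)).1 (Lp.memLp _)))

lemma integrable_inner_coeff (hπ : IsDiscreteSeries μ π) (g₁ g₂ f₁ f₂ : H) :
    Integrable (fun x => inner ℂ (coeff π g₂ f₂ x) (coeff π g₁ f₁ x)) μ := by
  obtain ⟨V₁, hV₁⟩ := hπ.exists_continuousLinearMap_ae_eq_coeff g₁
  obtain ⟨V₂, hV₂⟩ := hπ.exists_continuousLinearMap_ae_eq_coeff g₂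
  refine (L2.integrable_inner (𝕜 := ℂ) (V₂ f₂) (V₁ f₁)).congr ?_
  filter_upwards [hV₁ f₁, hV₂ f₂] with x h₁ h₂
  rw [h₁, h₂]

/- The operator `V_{g₂}† V_{g₁}` intertwines `π` with itself. -/
lemma exists_integral_inner_coeff_eq_mul_inner (hπ : IsDiscreteSeries μ π) (g₁ g₂ : H) :
    ∃ c : ℂ, ∀ f₁ f₂,
      ∫ x, inner ℂ (coeff π g₂ f₂ x) (coeff π g₁ f₁ x) ∂μ = c * inner ℂ f₂ f₁ := by
  obtain ⟨V₁, hV₁⟩ := hπ.exists_continuousLinearMap_ae_eq_coeff g₁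
  obtain ⟨V₂, hV₂⟩ := hπ.exists_continuousLinearMap_ae_eq_coeff g₂
  have hinner (f₁ f₂ : H) : inner ℂ f₂ (V₂.adjoint (V₁ f₁)) =
      ∫ x, inner ℂ (coeff π g₂ f₂ x) (coeff π g₁ f₁ x) ∂μ := by
    rw [V₂.adjoint_inner_right, L2.inner_def]
    refine integral_congr_ae ?_
    filter_upwards [hV₁ f₁, hV₂ f₂] with x h₁ h₂
    rw [h₁, h₂]
  obtain ⟨c, hc⟩ := hπ.irreducible.exists_eq_smul (T := V₂.adjoint ∘L V₁) fun y f => by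
    refine ext_inner_left ℂ fun v => ?_
    obtain ⟨w, rfl⟩ := (π y).surjective v
    rw [ContinuousLinearMap.comp_apply, hinner, hπ.integral_inner_coeff_apply,
      (π y).inner_map_map, ContinuousLinearMap.comp_apply, hinner]
  refine ⟨c, fun f₁ f₂ => ?_⟩
  rw [← hinner, ← inner_smul_right, ← hc, ContinuousLinearMap.comp_apply]

/- For fixed vectors the integral is a multiple of `⟨f₁, f₂⟩`, and by inversion invariance a
multiple of the conjugate of `⟨g₁, g₂⟩`, so a single constant governs all of them. -/
lemma exists_integral_inner_coeff_eq (hπ : IsDiscreteSeries μ π) :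
    ∃ c : ℂ, ∀ g₁ g₂ f₁ f₂,
      ∫ x, inner ℂ (coeff π g₂ f₂ x) (coeff π g₁ f₁ x) ∂μ = c * inner ℂ g₁ g₂ * inner ℂ f₂ f₁ := by
  obtain ⟨g₀, hg₀, -⟩ := hπ.squareIntegrable
  choose c hc using hπ.exists_integral_inner_coeff_eq_mul_inner
  have hswap (g₁ g₂ f₁ f₂ : H) : c g₁ g₂ * inner ℂ f₂ f₁ = c f₂ f₁ * inner ℂ g₁ g₂ := by
    rw [← hc, ← hc, ← integral_inv_eq_self _ μ]
    simp only [hπ.inner_coeff_inv]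
  have hinner₀ : inner ℂ g₀ g₀ ≠ 0 := inner_self_ne_zero.2 hg₀
  refine ⟨c g₀ g₀ / inner ℂ g₀ g₀, fun g₁ g₂ f₁ f₂ => ?_⟩
  rw [hc, div_mul_eq_mul_div, ← hswap g₁ g₂, mul_div_cancel_right₀ _ hinner₀]

lemma exists_isFormalDegree [LocallyCompactSpace G] [SecondCountableTopology G]
    [μ.IsOpenPosMeasure] (hπ : IsDiscreteSeries μ π) : ∃ d : ℝ, IsFormalDegree μ π d := by
  obtain ⟨c, hc⟩ := hπ.exists_integral_inner_coeff_eq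
  obtain ⟨g, hg, -⟩ := hπ.squareIntegrable
  set I : ℝ := ∫ x, ‖coeff π g g x‖ ^ 2 ∂μ
  have hI_eq : (I : ℂ) = c * (‖g‖ ^ 4 : ℝ) := by
    rw [← integral_complex_ofReal]
    simpa [← inner_self_eq_norm_sq_to_K (𝕜 := ℂ), mul_assoc, ← pow_add] using hc g g g g
  have hI_pos : 0 < I := by
    have hint : Integrable (fun x => ‖coeff π g g x‖ ^ 2) μ := by
      simpa only [inner_self_eq_norm_sq_to_K, norm_pow, RCLike.norm_ofReal, abs_norm] using
        (hπ.integrable_inner_coeff g g g g).norm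
    refine (integral_nonneg fun x => sq_nonneg ‖coeff π g g x‖).lt_of_ne' fun h => ?_
    rw [integral_eq_zero_iff_of_nonneg (fun x => sq_nonneg _) hint] at h
    have hzero := (Continuous.ae_eq_iff_eq μ ((hπ.continuous_norm_coeff g g).pow 2)
      continuous_zero).1 h
    simpa [hπ.norm_coeff_one, hg] using congrFun hzero 1
  have hg4 : 0 < ‖g‖ ^ 4 := by positivity
  refine ⟨‖g‖ ^ 4 / I, div_pos hg4 hI_pos, fun f₁ f₂ g₁ g₂ => ?_⟩
  have hmul (x : G) : coeff π g₁ f₁ x * inner ℂ f₂ (π x g₂) =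
      inner ℂ (coeff π g₂ f₂ x) (coeff π g₁ f₁ x) := by
    rw [RCLike.inner_apply, coeff, coeff, inner_conj_symm]
  have hconst : (((‖g‖ ^ 4 / I : ℝ) : ℂ))⁻¹ = c := by
    have hg4' : ((‖g‖ ^ 4 : ℝ) : ℂ) ≠ 0 := Complex.ofReal_ne_zero.2 hg4.ne'
    rw [Complex.ofReal_div, inv_div, hI_eq, mul_div_cancel_right₀ _ hg4']
  simp only [hmul]
  refine ⟨hπ.integrable_inner_coeff g₁ g₂ f₁ f₂, ?_⟩
  rw [hc, hconst, inner_conj_symm, mul_right_comm]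

end IsDiscreteSeries
end FormalDegree

section Trace

lemma ofReal_norm_sq {E : Type*} [SeminormedAddCommGroup E] (a : E) :
    ENNReal.ofReal (‖a‖ ^ 2) = ‖a‖ₑ ^ 2 := by
  rw [ENNReal.ofReal_pow (norm_nonneg a), ofReal_norm]

variable {H : Type*} [NormedAddCommGroup H] [InnerProductSpace ℂ H]

lemma enorm_starProjection_sq_eq_sum (W : Submodule ℂ H) [FiniteDimensional ℂ W] (u : H) :
    ‖W.starProjection u‖ₑ ^ 2 = ∑ i, ‖inner ℂ (stdOrthonormalBasis ℂ W i : H) u‖ₑ ^ 2 := by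
  have h := (stdOrthonormalBasis ℂ W).sum_sq_norm_inner_right (W.orthogonalProjectionOnto u)
  simp only [Submodule.inner_orthogonalProjectionOnto_eq_of_mem_left] at h
  rw [← ofReal_norm_sq, W.starProjection_apply, Submodule.norm_coe, ← h,
    ENNReal.ofReal_sum_of_nonneg fun _ _ => by positivity]
  simp only [ofReal_norm_sq]

variable {G : Type*} [MeasurableSpace G] {μ : Measure G} {π : G → H ≃ₗᵢ[ℂ] H} {d : ℝ}

lemma IsFormalDegree.lintegral_enorm_coeff_sq (hd : IsFormalDegree μ π d) (g f : H) :
    ∫⁻ x, ‖coeff π g f x‖ₑ ^ 2 ∂μ = (ENNReal.ofReal d)⁻¹ * (‖f‖ₑ ^ 2 * ‖g‖ₑ ^ 2) := by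
  obtain ⟨hint, heq⟩ := hd.2 f f g g
  have hmul (x : G) : coeff π g f x * inner ℂ f (π x g) = (‖coeff π g f x‖ ^ 2 : ℝ) := by
    rw [← inner_conj_symm f, ← coeff, Complex.mul_conj, Complex.normSq_eq_norm_sq]
  have hright : (d : ℂ)⁻¹ * inner ℂ f f * (starRingEnd ℂ) (inner ℂ g g) =
      (d⁻¹ * (‖f‖ ^ 2 * ‖g‖ ^ 2) : ℝ) := by
    simp [inner_self_eq_norm_sq_to_K, mul_assoc]
  simp only [hmul] at heq hint
  rw [hright, integral_complex_ofReal, Complex.ofReal_inj] at heq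
  have hint' : Integrable (fun x => ‖coeff π g f x‖ ^ 2) μ := by simpa using hint.norm
  have := ofReal_integral_eq_lintegral_ofReal hint' (.of_forall fun x => sq_nonneg _)
  rw [heq, ENNReal.ofReal_mul (inv_nonneg.2 hd.1.le), ENNReal.ofReal_mul (sq_nonneg _),
    ENNReal.ofReal_inv_of_pos hd.1] at this
  simpa only [ofReal_norm_sq] using this.symm

lemma IsFormalDegree.lintegral_enorm_starProjection_sq [Group G] (hd : IsFormalDegree μ π d)
    (hπ : IsProjectiveRep π) (W : Submodule ℂ H) [FiniteDimensional ℂ W] (g : H) :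
    ∫⁻ y, ‖W.starProjection (π y g)‖ₑ ^ 2 ∂μ =
      Module.finrank ℂ W * ((ENNReal.ofReal d)⁻¹ * ‖g‖ₑ ^ 2) := by
  have hcoeff (y : G) : ‖W.starProjection (π y g)‖ₑ ^ 2 =
      ∑ i, ‖coeff π g (stdOrthonormalBasis ℂ W i : H) y‖ₑ ^ 2 := by
    rw [enorm_starProjection_sq_eq_sum]
    simp only [coeff, ← ofReal_norm, norm_inner_symm (π y g)]
  simp only [hcoeff]
  rw [lintegral_finsetSum _ fun i _ => (hπ.stronglyMeasurable_coeff g _).enorm.pow_const 2]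
  have hone (i) : ‖(stdOrthonormalBasis ℂ W i : H)‖ₑ = 1 := by
    rw [← ofReal_norm, Submodule.norm_coe, (stdOrthonormalBasis ℂ W).norm_eq_one,
      ENNReal.ofReal_one]
  simp [hd.lintegral_enorm_coeff_sq, hone]

end Trace

section Frames

variable {ι : Type*}

lemma norm_sq_eq_tsum (a : lp (fun _ : ι => ℂ) 2) : ‖a‖ ^ 2 = ∑' i, ‖a i‖ ^ 2 := by
  simpa using lp.norm_rpow_eq_tsum (p := 2) (by norm_num) a

lemma enorm_sq_eq_tsum (a : lp (fun _ : ι => ℂ) 2) : ‖a‖ₑ ^ 2 = ∑' i, ‖a i‖ₑ ^ 2 := by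
  have hsum : Summable fun i => ‖a i‖ ^ 2 := by
    simpa using (lp.memℓp a).summable (by norm_num)
  rw [← ofReal_norm_sq, norm_sq_eq_tsum, ENNReal.ofReal_tsum_of_nonneg (fun _ => sq_nonneg _) hsum]
  simp only [ofReal_norm_sq]

lemma enorm_sum_single_sq [DecidableEq ι] (F : Finset ι) (a : ι → ℂ) :
    ‖(∑ i ∈ F, lp.single 2 i (a i) : lp (fun _ : ι => ℂ) 2)‖ₑ ^ 2 = ∑ i ∈ F, ‖a i‖ₑ ^ 2 := by
  have h := lp.norm_sum_single (p := 2) (by norm_num) a F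
  simp only [ENNReal.toReal_ofNat, Real.rpow_ofNat] at h
  rw [← ofReal_norm_sq, h, ENNReal.ofReal_sum_of_nonneg fun _ _ => sq_nonneg _]
  simp only [ofReal_norm_sq]

lemma sum_single_apply [DecidableEq ι] (F : Finset ι) (a : ι → ℂ) (j : ι) :
    (∑ i ∈ F, lp.single 2 i (a i) : lp (fun _ : ι => ℂ) 2) j = if j ∈ F then a j else 0 := by
  rw [lp.coeFn_sum]
  simp only [lp.coeFn_single, Finset.sum_apply, Finset.sum_pi_single]

lemma enorm_sub_sum_single_sq [DecidableEq ι] (F : Finset ι) (a : lp (fun _ : ι => ℂ) 2) :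
    ‖a - ∑ i ∈ F, lp.single 2 i (a i)‖ₑ ^ 2 = ∑' i : {i // i ∉ F}, ‖a i‖ₑ ^ 2 := by
  rw [enorm_sq_eq_tsum]
  refine Eq.trans (tsum_congr fun i => ?_) (tsum_subtype {i | i ∉ F} fun i => ‖a i‖ₑ ^ 2).symm
  rw [lp.coeFn_sub, Pi.sub_apply, sum_single_apply]
  by_cases hi : i ∈ F <;> simp [hi]

variable {H : Type*} [NormedAddCommGroup H] [InnerProductSpace ℂ H] {φ : ι → H}

namespace IsFrame

/-- The analysis operator `f ↦ (⟨f, φ i⟩)ᵢ` of a frame `φ`. -/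
noncomputable def analysis (h : IsFrame φ) : H →L[ℂ] lp (fun _ : ι => ℂ) 2 :=
  LinearMap.mkContinuousOfExistsBound
    { toFun f := ⟨fun i => inner ℂ (φ i) f, memℓp_gen <| by
        obtain ⟨_, _, _, _, h⟩ := h
        simpa using (h f).1⟩
      map_add' f f' := by
        ext i
        exact inner_add_right _ _ _
      map_smul' c f := by
        ext i
        exact inner_smul_right _ _ _ } <| by
    obtain ⟨_, B, _, hB, h⟩ := h
    refine ⟨√B, fun f => le_of_sq_le_sq ?_ (by positivity)⟩
    rw [norm_sq_eq_tsum, mul_pow, Real.sq_sqrt hB.le]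
    exact (h f).2.2

@[simp]
lemma analysis_apply (h : IsFrame φ) (f : H) (i : ι) : h.analysis f i = inner ℂ (φ i) f :=
  rfl

lemma norm_analysis_sq (h : IsFrame φ) (f : H) :
    ‖h.analysis f‖ ^ 2 = ∑' i, ‖inner ℂ (φ i) f‖ ^ 2 :=
  norm_sq_eq_tsum _

lemma exists_antilipschitzWith_analysis (h : IsFrame φ) :
    ∃ K, AntilipschitzWith K h.analysis := by
  obtain ⟨A, _, hA, _, hA_le⟩ := id h
  refine ⟨(√A)⁻¹.toNNReal, AddMonoidHomClass.antilipschitz_of_bound _ fun f => ?_⟩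
  rw [Real.coe_toNNReal _ (by positivity), ← div_eq_inv_mul, le_div_iff₀ (by positivity)]
  refine le_of_sq_le_sq ?_ (norm_nonneg _)
  rw [norm_analysis_sq, mul_pow, Real.sq_sqrt hA.le, mul_comm]
  exact (hA_le f).2.1

lemma exists_tsum_enorm_inner_sq_le (h : IsFrame φ) :
    ∃ B : ℝ≥0∞, B ≠ ∞ ∧ ∀ f, ∑' i, ‖inner ℂ (φ i) f‖ₑ ^ 2 ≤ B * ‖f‖ₑ ^ 2 := by
  refine ⟨‖h.analysis‖ₑ ^ 2, by finiteness, fun f => ?_⟩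
  simp only [← h.analysis_apply, ← enorm_sq_eq_tsum, ← mul_pow]
  gcongr
  exact h.analysis.le_opENorm f

variable [CompleteSpace H]

lemma isClosed_range_analysis (h : IsFrame φ) :
    IsClosed (h.analysis.range : Set (lp (fun _ : ι => ℂ) 2)) := by
  obtain ⟨K, hK⟩ := h.exists_antilipschitzWith_analysis
  exact hK.isClosed_range h.analysis.uniformContinuous

instance (h : IsFrame φ) : CompleteSpace h.analysis.range :=
  h.isClosed_range_analysis.completeSpace_coe

lemma hasLeftInverse_analysis (h : IsFrame φ) : h.analysis.HasLeftInverse := by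
  obtain ⟨K, hK⟩ := h.exists_antilipschitzWith_analysis
  exact .of_injective_of_isClosed_range_of_closedComplement_range hK.injective
    h.isClosed_range_analysis ⟨h.analysis.range.orthogonalProjectionOnto,
      Submodule.orthogonalProjectionOnto_mem_subspace_eq_self⟩

lemma exists_submodule_enorm_sub_starProjection_sq_le (h : IsFrame φ) :
    ∃ K : ℝ≥0∞, K ≠ ∞ ∧ ∀ F : Finset ι,
      ∃ (W : Submodule ℂ H) (_ : FiniteDimensional ℂ W), Module.finrank ℂ W ≤ F.card ∧
        ∀ u, ‖u - W.starProjection u‖ₑ ^ 2 ≤ K * ∑' i : {i // i ∉ F}, ‖inner ℂ (φ i) u‖ₑ ^ 2 := by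
  classical
  set L := h.hasLeftInverse_analysis.leftInverse
  have hL (u : H) : L (h.analysis u) = u := h.hasLeftInverse_analysis.leftInverse_leftInverse u
  refine ⟨‖L‖ₑ ^ 2, by finiteness, fun F => ?_⟩
  set W := Submodule.span ℂ (F.image fun i => L (lp.single 2 i 1) : Set H)
  have hmem (i : ι) (hi : i ∈ F) (c : ℂ) : L (lp.single 2 i c) ∈ W := by
    have : (lp.single 2 i c : lp (fun _ : ι => ℂ) 2) = c • lp.single 2 i 1 := by
      rw [← lp.single_smul, smul_eq_mul, mul_one]
    rw [this, map_smul]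
    exact W.smul_mem _ (Submodule.subset_span (Finset.mem_image_of_mem _ hi))
  refine ⟨W, inferInstance, (finrank_span_finset_le_card _).trans Finset.card_image_le,
    fun u => ?_⟩
  set a := h.analysis u
  have hbest : ‖u - W.starProjection u‖ₑ ≤ ‖L (a - ∑ i ∈ F, lp.single 2 i (a i))‖ₑ := by
    have hv : L (∑ i ∈ F, lp.single 2 i (a i)) ∈ W := by
      rw [map_sum]
      exact sum_mem fun i hi => hmem i hi _
    rw [map_sub, hL, enorm_le_iff_norm_le, W.starProjection_minimal]
    exact ciInf_le ⟨0, Set.forall_mem_range.2 fun _ => norm_nonneg _⟩ (⟨_, hv⟩ : W)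
  calc ‖u - W.starProjection u‖ₑ ^ 2
      ≤ (‖L‖ₑ * ‖a - ∑ i ∈ F, lp.single 2 i (a i)‖ₑ) ^ 2 := by
        gcongr
        exact hbest.trans (L.le_opENorm _)
    _ = _ := by rw [mul_pow, enorm_sub_sum_single_sq]; simp [a]

lemma inner_starProjection_single_analysis [DecidableEq ι] (h : IsFrame φ) (j : ι) (f : H) :
    inner ℂ (h.analysis.range.starProjection (lp.single 2 j 1)) (h.analysis f) =
      inner ℂ (φ j) f := by
  have hf : h.analysis.range.starProjection (h.analysis f) = h.analysis f :=
    Submodule.starProjection_eq_self_iff.2 ⟨f, rfl⟩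
  rw [Submodule.inner_starProjection_left_eq_right, hf, lp.inner_single_left]
  simp

/- If `e` is the `j`-th unit vector and `P` the projection onto the range of the analysis operator
`C`, then `|⟨f, φ j⟩| = |⟨e, C f⟩| = |⟨P e, C f⟩| ≤ ‖P e‖ ‖C f‖` with `‖P e‖ < 1`, so omitting the
`j`-th coefficient keeps a fixed proportion of `‖C f‖²`. -/
lemma subtype_ne [DecidableEq ι] (h : IsFrame φ) {j : ι}
    (hj : lp.single 2 j 1 ∉ h.analysis.range) : IsFrame fun i : {i // i ≠ j} => φ i := by
  obtain ⟨A, B, hA, hB, hAB⟩ := id h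
  set e : lp (fun _ : ι => ℂ) 2 := lp.single 2 j 1
  set P := h.analysis.range.starProjection
  have he : ‖e‖ = 1 := by rw [lp.norm_single (by norm_num), norm_one]
  have hPe : ‖P e‖ < 1 := by
    refine lt_of_le_of_ne (he ▸ h.analysis.range.norm_starProjection_apply_le e) fun heq => hj ?_
    rwa [Submodule.mem_iff_norm_starProjection, he]
  have hcoord (f : H) : ‖inner ℂ (φ j) f‖ ^ 2 ≤ ‖P e‖ ^ 2 * ‖h.analysis f‖ ^ 2 := by
    rw [← h.inner_starProjection_single_analysis, ← mul_pow]
    exact pow_le_pow_left₀ (norm_nonneg _) (norm_inner_le_norm _ _) 2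
  have hsplit (f : H) : ‖inner ℂ (φ j) f‖ ^ 2 + ∑' i : {i // i ≠ j}, ‖inner ℂ (φ i) f‖ ^ 2 =
      ‖h.analysis f‖ ^ 2 := by
    rw [norm_analysis_sq, ← (hAB f).1.tsum_subtype_add_tsum_subtype_compl {j},
      tsum_singleton j fun i => ‖inner ℂ (φ i) f‖ ^ 2]
    rfl
  have hPe_sq : ‖P e‖ ^ 2 < 1 := pow_lt_one₀ (norm_nonneg _) hPe two_ne_zero
  refine ⟨(1 - ‖P e‖ ^ 2) * A, B, mul_pos (sub_pos.2 hPe_sq) hA, hB,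
    fun f => ⟨(hAB f).1.subtype _, ?_, ?_⟩⟩
  · calc (1 - ‖P e‖ ^ 2) * A * ‖f‖ ^ 2 ≤ (1 - ‖P e‖ ^ 2) * ‖h.analysis f‖ ^ 2 := by
          rw [mul_assoc, norm_analysis_sq]
          exact mul_le_mul_of_nonneg_left (hAB f).2.1 (sub_pos.2 hPe_sq).le
      _ ≤ ‖h.analysis f‖ ^ 2 - ‖inner ℂ (φ j) f‖ ^ 2 := by linarith [hcoord f]
      _ = _ := sub_eq_of_eq_add' (hsplit f).symm
  · refine (le_add_of_nonneg_left (sq_nonneg ‖inner ℂ (φ j) f‖)).trans ?_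
    rw [hsplit, norm_analysis_sq]
    exact (hAB f).2.2

end IsFrame

namespace IsRieszBasis

variable [CompleteSpace H]

lemma surjective_analysis (h : IsRieszBasis φ) : Function.Surjective h.1.analysis := by
  classical
  have hsingle (i : ι) (c : ℂ) : lp.single 2 i c ∈ h.1.analysis.range := by
    have hone : lp.single 2 i 1 ∈ h.1.analysis.range := by
      by_contra hi
      exact h.2 i (h.1.subtype_ne hi)
    have : (lp.single 2 i c : lp (fun _ : ι => ℂ) 2) = c • lp.single 2 i 1 := by
      rw [← lp.single_smul, smul_eq_mul, mul_one]
    rw [this]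
    exact Submodule.smul_mem _ c hone
  intro a
  exact h.1.isClosed_range_analysis.mem_of_tendsto (lp.hasSum_single ENNReal.ofNat_ne_top a)
    (.of_forall fun F => sum_mem fun i _ => hsingle i _)

lemma linearIndependent (h : IsRieszBasis φ) : LinearIndependent ℂ φ := by
  classical
  refine linearIndependent_iff'.2 fun F c hc j hj => ?_
  obtain ⟨u, hu⟩ := h.surjective_analysis (lp.single 2 j 1)
  have hbiorthogonal (i : ι) : inner ℂ (φ i) u = Pi.single (M := fun _ => ℂ) j 1 i := by
    rw [← h.1.analysis_apply, hu, lp.coeFn_single]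
  have : inner ℂ (∑ i ∈ F, c i • φ i) u = 0 := by rw [hc, inner_zero_left]
  simpa [sum_inner, inner_smul_left, hbiorthogonal, Pi.single_apply, hj] using this

lemma exists_submodule_enorm_starProjection_sq_le (h : IsRieszBasis φ) :
    ∃ K : ℝ≥0∞, K ≠ ∞ ∧ ∀ F : Finset ι,
      ∃ (W : Submodule ℂ H) (_ : FiniteDimensional ℂ W), Module.finrank ℂ W = F.card ∧
        ∀ u, ‖W.starProjection u‖ₑ ^ 2 ≤ K * ∑ i ∈ F, ‖inner ℂ (φ i) u‖ₑ ^ 2 := by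
  classical
  obtain ⟨C, -, hC⟩ := h.1.analysis.exists_preimage_norm_le h.surjective_analysis
  refine ⟨‖C‖ₑ ^ 2, by finiteness, fun F => ?_⟩
  set W := Submodule.span ℂ (F.image φ : Set H)
  have hrank : Module.finrank ℂ W = F.card := by
    rw [finrank_span_finset_eq_card,
      Finset.card_image_of_injective F h.linearIndependent.injective]
    rw [Finset.coe_image]
    exact h.linearIndependent.linearIndepOn_id.mono (Set.image_subset_range φ F)
  refine ⟨W, inferInstance, hrank, fun u => ?_⟩
  obtain ⟨v, hv, hv_norm⟩ := hC (∑ i ∈ F, lp.single 2 i (inner ℂ (φ i) u))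
  have hproj : W.starProjection u = W.starProjection v := by
    rw [← sub_eq_zero, ← map_sub, Submodule.starProjection_apply_eq_zero_iff]
    suffices W ≤ (Submodule.span ℂ {u - v})ᗮ from fun w hw =>
      Submodule.mem_orthogonal_singleton_iff_inner_left.1 (this hw)
    refine Submodule.span_le.2 fun w hw => Submodule.mem_orthogonal_singleton_iff_inner_left.2 ?_
    obtain ⟨i, hi, rfl⟩ := Finset.mem_image.1 hw
    rw [inner_sub_right, ← h.1.analysis_apply v, hv, sum_single_apply, if_pos hi, sub_self]
  calc ‖W.starProjection u‖ₑ ^ 2 ≤ ‖v‖ₑ ^ 2 := by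
        rw [hproj]
        gcongr
        exact enorm_le_iff_norm_le.2 (W.norm_starProjection_apply_le v)
    _ ≤ (‖C‖ₑ * ‖(∑ i ∈ F, lp.single 2 i (inner ℂ (φ i) u) : lp (fun _ : ι => ℂ) 2)‖ₑ) ^ 2 := by
        gcongr
        rw [← enorm_norm (∑ i ∈ F, _), ← enorm_mul, enorm_le_iff_norm_le]
        exact hv_norm.trans (le_abs_self _)
    _ = _ := by rw [mul_pow, enorm_sum_single_sq]

end IsRieszBasis

end Frames

section Integrals

variable {X : Type*} [TopologicalSpace X] [MeasurableSpace X] {μ : Measure X}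

lemma exists_isCompact_setLIntegral_compl_le [T2Space X] [LocallyCompactSpace X]
    [SecondCountableTopology X] [BorelSpace X] {w : X → ℝ≥0∞} (hw : ∫⁻ x, w x ∂μ ≠ ∞)
    {ε : ℝ≥0∞} (hε : ε ≠ 0) :
    ∃ C, IsCompact C ∧ ∫⁻ x in Cᶜ, w x ∂μ ≤ ε := by
  have := isFiniteMeasure_withDensity hw
  obtain ⟨C, -, hC, hC_lt⟩ := (MeasurableSet.univ (α := X)).exists_isCompact_sdiff_lt
    (measure_ne_top (μ.withDensity w) _) hε
  rw [← Set.compl_eq_univ_sdiff, withDensity_apply _ hC.measurableSet.compl] at hC_lt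
  exact ⟨C, hC, hC_lt.le⟩

lemma le_essSup_restrict_of_mem_interior [μ.IsOpenPosMeasure] {f : X → ℝ≥0∞}
    (hf : Continuous f) {s : Set X} {x : X} (hx : x ∈ interior s) :
    f x ≤ essSup f (μ.restrict s) := by
  by_contra! hlt
  have hopen : IsOpen ({y | essSup f (μ.restrict s) < f y} ∩ interior s) :=
    (isOpen_lt continuous_const hf).inter isOpen_interior
  refine (hopen.measure_pos μ ⟨x, hlt, hx⟩).ne' (measure_mono_null ?_ (nonpos_iff_eq_zero.1
    ((Measure.le_restrict_apply s _).trans_eq (meas_essSup_lt (f := f)))))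
  exact Set.inter_subset_inter_right _ interior_subset

end Integrals

section Counting

variable {G : Type*} [Group G] [TopologicalSpace G]

/-- A set is relatively separated if the number of its points in a translate `x • V` of some
neighbourhood `V` of `1` is bounded uniformly in `x`. -/
def IsRelativelySeparated (Λ : Set G) : Prop :=
  ∃ V ∈ 𝓝 (1 : G), ∃ R : ℝ≥0∞, R ≠ ∞ ∧ ∀ x : G, ((Λ ∩ x • V).encard : ℝ≥0∞) ≤ R

variable [IsTopologicalGroup G] [MeasurableSpace G] [BorelSpace G] {μ : Measure G}

/- Tonelli: both sides count the pairs `(i, y)` with `y ∈ p i • V`, weighted by `w y`. -/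
lemma tsum_setLIntegral_smul {ι : Type*} [Countable ι] (p : ι → G) {V : Set G}
    (hV : MeasurableSet V) {w : G → ℝ≥0∞} (hw : AEMeasurable w μ) :
    ∑' i, ∫⁻ y in p i • V, w y ∂μ =
      ∫⁻ y, ({i | p i ∈ y • V⁻¹}.encard : ℝ≥0∞) * w y ∂μ := by
  have hmeas (i : ι) : MeasurableSet (p i • V) := hV.const_smul (p i)
  simp only [← lintegral_indicator (hmeas _)]
  rw [← lintegral_tsum fun i => hw.indicator (hmeas i)]
  refine lintegral_congr fun y => ?_
  classical
  rw [← ENNReal.tsum_set_const, tsum_subtype {i | p i ∈ y • V⁻¹} fun _ => w y]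
  refine tsum_congr fun i => ?_
  simp only [Set.indicator_apply, Set.mem_smul_set_iff_inv_smul_mem, smul_eq_mul,
    Set.mem_ofPred_eq, Set.mem_inv, mul_inv_rev, inv_inv]

lemma tsum_setLIntegral_smul_le {ι : Type*} [Countable ι] (p : ι → G) {V T : Set G}
    (hV : MeasurableSet V) (hT : MeasurableSet T) (hVT : ∀ i, p i • V ⊆ T) {R : ℝ≥0∞}
    (hR : ∀ y : G, ({i | p i ∈ y • V⁻¹}.encard : ℝ≥0∞) ≤ R) {w : G → ℝ≥0∞} (hw : AEMeasurable w μ) :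
    ∑' i, ∫⁻ y in p i • V, w y ∂μ ≤ R * ∫⁻ y in T, w y ∂μ := by
  calc ∑' i, ∫⁻ y in p i • V, w y ∂μ = ∑' i, ∫⁻ y in p i • V, T.indicator w y ∂μ :=
        tsum_congr fun i => setLIntegral_congr_fun (hV.const_smul (p i)) fun y hy =>
          (Set.indicator_of_mem (hVT i hy) w).symm
    _ ≤ ∫⁻ y, R * T.indicator w y ∂μ := by
        rw [tsum_setLIntegral_smul p hV (hw.indicator hT)]
        exact lintegral_mono fun y => by gcongr; exact hR y
    _ = R * ∫⁻ y in T, w y ∂μ := by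
        rw [lintegral_const_mul'' _ (hw.indicator hT), lintegral_indicator hT]

lemma encard_inter_mul_measure [μ.IsMulLeftInvariant] {Λ S V : Set G} (hΛ : Λ.Countable)
    (hV : MeasurableSet V) :
    ((Λ ∩ S).encard : ℝ≥0∞) * μ V = ∫⁻ y, ((Λ ∩ S ∩ y • V⁻¹).encard : ℝ≥0∞) ∂μ := by
  have := (hΛ.mono (Set.inter_subset_left (t := S))).to_subtype
  have h := tsum_setLIntegral_smul (μ := μ) ((↑) : ↥(Λ ∩ S) → G) hV (w := 1) aemeasurable_one
  simp only [Pi.one_apply, setLIntegral_one, measure_smul, ENNReal.tsum_set_const, mul_one] at h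
  rw [h]
  refine lintegral_congr fun y => ?_
  rw [← Subtype.val_injective.encard_image]
  congr 2
  exact Subtype.image_preimage_coe _ _

omit [BorelSpace G] in
lemma IsRelativelySeparated.exists_isOpen [LocallyCompactSpace G] [μ.IsHaarMeasure]
    {Λ Q : Set G} (hsep : IsRelativelySeparated Λ) (hQ : Q ∈ 𝓝 1) :
    ∃ V P : Set G, IsOpen V ∧ IsCompact P ∧ 1 ∈ P ∧ V ⊆ P ∧ V⁻¹ ⊆ interior Q ∧
      μ V ≠ 0 ∧ μ V ≠ ∞ ∧ ∃ R : ℝ≥0∞, R ≠ ∞ ∧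
        ∀ x : G, ((Λ ∩ x • V⁻¹).encard : ℝ≥0∞) ≤ R := by
  obtain ⟨W, hW, R, hR, hR_le⟩ := hsep
  obtain ⟨P, hP_nhds, hP_sub, hP⟩ := local_compact_nhds (inter_mem hW hQ)
  have hV : IsOpen (interior P)⁻¹ := isOpen_interior.inv
  have hV_sub : (interior P)⁻¹ ⊆ P⁻¹ := Set.inv_subset_inv.2 interior_subset
  refine ⟨(interior P)⁻¹, P⁻¹, hV, hP.inv, by simpa using mem_of_mem_nhds hP_nhds, hV_sub, ?_,
    (hV.measure_pos μ ⟨1, by simpa using mem_interior_iff_mem_nhds.2 hP_nhds⟩).ne',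
    measure_ne_top_of_subset hV_sub hP.inv.measure_ne_top, R, hR, fun x => le_trans ?_ (hR_le x)⟩
  · rw [inv_inv]
    exact interior_mono fun _ h => (hP_sub h).2
  · rw [inv_inv]
    gcongr
    exact fun _ h => (hP_sub (interior_subset h)).1

lemma IsRelativelySeparated.exists_encard_inter_le [LocallyCompactSpace G] (μ : Measure G)
    [μ.IsHaarMeasure] {Λ : Set G} (hΛ : Λ.Countable) (hsep : IsRelativelySeparated Λ) :
    ∃ P : Set G, IsCompact P ∧ 1 ∈ P ∧ ∃ κ : ℝ≥0∞, κ ≠ ∞ ∧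
      ∀ S : Set G, ((Λ ∩ S).encard : ℝ≥0∞) ≤ κ * μ (S * P) := by
  obtain ⟨V, P, hV, hP, hP_one, hVP, -, hV_zero, hV_top, R, hR, hR_le⟩ :=
    hsep.exists_isOpen (μ := μ) univ_mem
  refine ⟨P, hP, hP_one, R / μ V, ENNReal.div_ne_top hR hV_zero, fun S => ?_⟩
  rw [← ENNReal.mul_div_right_comm, ENNReal.le_div_iff_mul_le (.inl hV_zero) (.inl hV_top),
    encard_inter_mul_measure hΛ hV.measurableSet]
  calc ∫⁻ y, ((Λ ∩ S ∩ y • V⁻¹).encard : ℝ≥0∞) ∂μ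
      ≤ ∫⁻ y, (S * V).indicator (fun _ => R) y ∂μ := by
        refine lintegral_mono fun y => ?_
        rcases (Λ ∩ S ∩ y • V⁻¹).eq_empty_or_nonempty with hempty | ⟨_, ⟨-, hS⟩, v, hv, rfl⟩
        · simp [hempty]
        · have hy : y ∈ S * V := ⟨_, hS, v⁻¹, hv, mul_inv_cancel_right y v⟩
          rw [Set.indicator_of_mem hy]
          refine le_trans ?_ (hR_le y)
          gcongr
          exact Set.inter_subset_left
    _ = R * μ (S * V) := lintegral_indicator_const hV.mul_left.measurableSet R
    _ ≤ R * μ (S * P) := by gcongr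

omit [BorelSpace G] in
lemma enorm_le_localMaximal [μ.IsOpenPosMeasure] {F : G → ℂ} (hF : Continuous fun x => ‖F x‖)
    {Q : Set G} {x y : G} (hxy : x⁻¹ * y ∈ interior Q) : ‖F y‖ₑ ≤ localMaximal μ Q F x := by
  have hcont : Continuous fun z => ‖F (x * z)‖ₑ := by
    simp only [← ofReal_norm]
    exact ENNReal.continuous_ofReal.comp (hF.comp (continuous_const_mul x))
  simpa [localMaximal] using le_essSup_restrict_of_mem_interior (μ := μ) hcont hxy

omit [IsTopologicalGroup G] [BorelSpace G] in
lemma MemWienerAmalgam.lintegral_localMaximal_sq_ne_top {F : G → ℂ} {Q : Set G}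
    (hF : MemWienerAmalgam μ Q 2 F) : ∫⁻ x, localMaximal μ Q F x ^ 2 ∂μ ≠ ∞ := by
  have := (eLpNorm_lt_top_iff_lintegral_rpow_enorm_lt_top (by simp) (by simp)).1 hF.memLp.2
  simpa using this.ne

/- Each summand is at most the average of the squared local maximal function over a neighbourhood
of `y⁻¹ * l`, and these neighbourhoods overlap boundedly often. -/
lemma MemWienerAmalgam.exists_tsum_enorm_sq_le [T2Space G] [LocallyCompactSpace G]
    [SecondCountableTopology G] [μ.IsHaarMeasure] {F : G → ℂ} {Q Λ : Set G}
    (hF : MemWienerAmalgam μ Q 2 F) (hF_cont : Continuous fun x => ‖F x‖) (hQ : Q ∈ 𝓝 1)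
    (hΛ : Λ.Countable) (hsep : IsRelativelySeparated Λ) {ε : ℝ≥0∞} (hε : ε ≠ 0) :
    ∃ C : Set G, IsCompact C ∧ 1 ∈ C ∧
      ∀ y : G, ∑' l : {l : Λ // (l : G) ∉ y • C}, ‖F (y⁻¹ * l)‖ₑ ^ 2 ≤ ε := by
  obtain ⟨V, P, hV, hP, -, hVP, hVQ, hV_zero, hV_top, R, hR, hR_le⟩ :=
    hsep.exists_isOpen (μ := μ) hQ
  obtain ⟨C, hC, hC_le⟩ := exists_isCompact_setLIntegral_compl_le
    hF.lintegral_localMaximal_sq_ne_top (ε := ε * μ V / R)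
    (ENNReal.div_ne_zero.2 ⟨mul_ne_zero hε hV_zero, hR⟩)
  refine ⟨insert 1 (C * P⁻¹), (hC.mul hP.inv).insert 1, Set.mem_insert _ _, fun y => ?_⟩
  have := hΛ.to_subtype
  set p := fun l : {l : Λ // (l : G) ∉ y • insert 1 (C * P⁻¹)} => y⁻¹ * (l : G)
  have hdisjoint (l) : p l • V ⊆ Cᶜ := by
    rintro _ ⟨v, hv, rfl⟩ hvC
    refine l.2 (Set.smul_set_mono (Set.subset_insert _ _) (Set.mem_smul_set_iff_inv_smul_mem.2 ?_))
    exact ⟨_, hvC, v⁻¹, Set.inv_mem_inv.2 (hVP hv), mul_inv_cancel_right _ _⟩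
  have hoverlap (z : G) : ({l | p l ∈ z • V⁻¹}.encard : ℝ≥0∞) ≤ R := by
    refine le_trans (ENat.toENNReal_le.2 ?_) (hR_le (y * z))
    refine Set.encard_le_encard_of_injOn (f := fun l => ((l : Λ) : G)) (fun l hl => ⟨l.1.2, ?_⟩)
      (Subtype.val_injective.comp Subtype.val_injective).injOn
    rwa [mul_smul, Set.mem_smul_set_iff_inv_smul_mem]
  refine (ENNReal.mul_le_mul_iff_left hV_zero hV_top).1 ?_
  calc (∑' l, ‖F (p l)‖ₑ ^ 2) * μ V = ∑' l, ∫⁻ z in p l • V, ‖F (p l)‖ₑ ^ 2 ∂μ := by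
        simp only [setLIntegral_const, measure_smul, ENNReal.tsum_mul_right]
    _ ≤ ∑' l, ∫⁻ z in p l • V, localMaximal μ Q F z ^ 2 ∂μ := by
        refine ENNReal.tsum_le_tsum fun l => setLIntegral_mono' (hV.smul _).measurableSet ?_
        rintro _ ⟨v, hv, rfl⟩
        gcongr
        refine enorm_le_localMaximal hF_cont (hVQ ?_)
        simpa using hv
    _ ≤ R * ∫⁻ z in Cᶜ, localMaximal μ Q F z ^ 2 ∂μ :=
        tsum_setLIntegral_smul_le p hV.measurableSet hC.measurableSet.compl hdisjoint hoverlap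
          (hF.memLp.1.aemeasurable.pow_const 2)
    _ ≤ R * (ε * μ V / R) := by gcongr
    _ ≤ ε * μ V := ENNReal.mul_div_le

end Counting

section Density

variable {G : Type*} [Group G] [TopologicalSpace G] [MeasurableSpace G] {μ : Measure G}

lemma IsFolner.tendsto_measure_mul_div [IsFiniteMeasureOnCompacts μ] {K : ℕ → Set G}
    (hK : IsFolner μ K) {C : Set G} (hC : IsCompact C) (hC_one : 1 ∈ C) :
    Tendsto (fun n => μ (K n * C) / μ (K n)) atTop (𝓝 1) := by
  have hself (n : ℕ) : μ (K n) / μ (K n) = 1 :=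
    ENNReal.div_self (hK.measure_ne_zero n) (hK.isCompact n).measure_ne_top
  have hlim := (hK.tendsto_symmDiff C hC ⟨1, hC_one⟩).const_add 1
  rw [add_zero] at hlim
  refine tendsto_of_tendsto_of_tendsto_of_le_of_le tendsto_const_nhds hlim (fun n => ?_)
    fun n => ?_
  · rw [← hself n]
    gcongr
    exact Set.subset_mul_left _ hC_one
  · rw [← hself n, ← ENNReal.add_div]
    gcongr
    refine (measure_mono fun x hx => ?_).trans (measure_union_le _ _)
    by_cases hxK : x ∈ K n
    exacts [.inl hxK, .inr (.inl ⟨hx, hxK⟩)]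

omit [TopologicalSpace G] in
lemma countRatio_mul_measure {K : Set G} (Λ : Set G) (hK_zero : μ K ≠ 0) (hK_top : μ K ≠ ∞)
    (x : G) : countRatio μ Λ K x * μ K = ((Λ ∩ x • K).encard : ℝ≥0∞) :=
  ENNReal.div_mul_cancel hK_zero hK_top

variable (μ) in
/-- The largest `D` such that for some compact `L` of positive measure every translate of `L`
contains at least `D * μ L` points of `Λ`, up to approximation. It is the common value of the
lower Beurling density along all strong Følner sequences if `Λ` is relatively separated. -/
noncomputable def lowerDensity (Λ : Set G) : ℝ≥0∞ :=
  ⨆ (L : Set G) (_ : IsCompact L) (_ : μ L ≠ 0), ⨅ x : G, countRatio μ Λ L x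

lemma iInf_countRatio_le_lowerDensity {L : Set G} (Λ : Set G) (hL : IsCompact L)
    (hL_zero : μ L ≠ 0) : ⨅ x : G, countRatio μ Λ L x ≤ lowerDensity μ Λ :=
  le_iSup₂_of_le L hL (le_iSup_of_le hL_zero le_rfl)

variable [IsTopologicalGroup G]

lemma le_lowerDensity [IsFiniteMeasureOnCompacts μ] (hG : IsAmenable μ) {Λ : Set G} {d : ℝ≥0∞}
    (h : ∀ θ < 1, ∃ C : Set G, IsCompact C ∧ 1 ∈ C ∧ ∀ K : Set G, IsCompact K → ∀ x : G,
      θ * d * μ K ≤ ((Λ ∩ x • (K * C)).encard : ℝ≥0∞)) :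
    d ≤ lowerDensity μ Λ := by
  obtain ⟨K, hK⟩ := hG
  refine ENNReal.le_of_forall_lt_one_mul_le fun θ hθ => ?_
  obtain ⟨C, hC, hC_one, hKC⟩ := h θ hθ
  have hlim := ENNReal.Tendsto.const_mul (a := lowerDensity μ Λ)
    (hK.tendsto_measure_mul_div hC hC_one) (.inl one_ne_zero)
  rw [mul_one] at hlim
  refine ge_of_tendsto' hlim fun n => ?_
  have hK_zero := hK.measure_ne_zero n
  have hKC_compact : IsCompact (K n * C) := (hK.isCompact n).mul hC
  have hKC_zero : μ (K n * C) ≠ 0 := fun h =>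
    hK_zero (measure_mono_null (Set.subset_mul_left _ hC_one) h)
  rw [← mul_div_assoc, ENNReal.le_div_iff_mul_le (.inl hK_zero)
    (.inl (hK.isCompact n).measure_ne_top),
    ← ENNReal.div_le_iff hKC_zero hKC_compact.measure_ne_top]
  refine le_trans (le_iInf fun x => ?_)
    (iInf_countRatio_le_lowerDensity Λ hKC_compact hKC_zero)
  rw [countRatio]
  gcongr
  exact hKC _ (hK.isCompact n) x

omit [IsTopologicalGroup G] in
lemma HasLowerBeurlingDensity.hasUpperBeurlingDensity [IsFiniteMeasureOnCompacts μ] {Λ : Set G}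
    {d D : ℝ≥0∞} (hD : HasLowerBeurlingDensity μ Λ D) (hdD : d ≤ D)
    (h : ∀ θ < 1, ∃ C : Set G, IsCompact C ∧ 1 ∈ C ∧ ∀ K : Set G, IsCompact K → ∀ x : G,
      θ * ((Λ ∩ x • K).encard : ℝ≥0∞) ≤ d * μ (K * C)) :
    HasUpperBeurlingDensity μ Λ d := by
  intro K hK
  refine tendsto_of_le_liminf_of_limsup_le ?_ ?_
  · refine (hdD.trans_eq (hD K hK).liminf_eq.symm).trans (liminf_le_liminf (.of_forall fun n => ?_))
    exact iInf_le_iSup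
  · refine ENNReal.le_of_forall_lt_one_mul_le fun θ hθ => ?_
    obtain ⟨C, hC, hC_one, hKC⟩ := h θ hθ
    have hlim := ENNReal.Tendsto.const_mul (a := d)
      (hK.tendsto_measure_mul_div hC hC_one) (.inl one_ne_zero)
    rw [mul_one] at hlim
    rw [← ENNReal.limsup_const_mul_of_ne_top (hθ.trans ENNReal.one_lt_top).ne, ← hlim.limsup_eq]
    refine limsup_le_limsup (.of_forall fun n => ?_)
    beta_reduce
    rw [ENNReal.mul_iSup]
    refine iSup_le fun x => ?_
    rw [countRatio, ← mul_div_assoc, ← mul_div_assoc]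
    exact ENNReal.div_le_div_right (hKC _ (hK.isCompact n) x) _

/- Enlarging `K` to `K * C` adds only points within the `C * P ∪ P`-boundary of `K`. -/
omit [TopologicalSpace G] [IsTopologicalGroup G] in
lemma encard_inter_smul_mul_le [μ.IsMulLeftInvariant] {Λ P : Set G} {κ : ℝ≥0∞}
    (hκ : ∀ S : Set G, ((Λ ∩ S).encard : ℝ≥0∞) ≤ κ * μ (S * P)) (K C : Set G) (x : G) :
    ((Λ ∩ x • (K * C)).encard : ℝ≥0∞) ≤ ((Λ ∩ x • K).encard : ℝ≥0∞) +
      κ * μ ((K * (C * P ∪ P)) ∩ (Kᶜ * (C * P ∪ P))) := by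
  have hsplit : Λ ∩ x • (K * C) ⊆ (Λ ∩ x • K) ∪ (Λ ∩ x • ((K * C) \ K)) := by
    rw [← Set.inter_union_distrib_left, ← Set.smul_set_union, Set.union_sdiff_self]
    gcongr
    exact Set.subset_union_right
  have hboundary : ((K * C) \ K) * P ⊆ (K * (C * P ∪ P)) ∩ (Kᶜ * (C * P ∪ P)) := by
    refine Set.subset_inter ?_ (Set.mul_subset_mul (fun _ h => h.2) Set.subset_union_right)
    rw [Set.mul_union, ← mul_assoc]
    exact (Set.mul_subset_mul_right Set.sdiff_subset).trans Set.subset_union_left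
  calc ((Λ ∩ x • (K * C)).encard : ℝ≥0∞)
      ≤ ((Λ ∩ x • K).encard : ℝ≥0∞) + ((Λ ∩ x • ((K * C) \ K)).encard : ℝ≥0∞) := by
        rw [← ENat.toENNReal_add]
        exact ENat.toENNReal_le.2 ((Set.encard_le_encard hsplit).trans (Set.encard_union_le _ _))
    _ ≤ ((Λ ∩ x • K).encard : ℝ≥0∞) + κ * μ (((K * C) \ K) * P) := by
        grw [hκ (x • ((K * C) \ K)), smul_mul_assoc, measure_smul]
    _ ≤ _ := by gcongr

variable [BorelSpace G]

/- Average `#(Λ ∩ y • L)` over `y ∈ x • K`. -/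
lemma iInf_countRatio_mul_measure_le [T2Space G] [μ.IsMulLeftInvariant] [μ.IsInvInvariant]
    [IsFiniteMeasureOnCompacts μ] {Λ K L : Set G} (hΛ : Λ.Countable) (hK : IsCompact K)
    (hL : IsCompact L) (hL_zero : μ L ≠ 0) (x : G) :
    (⨅ y : G, countRatio μ Λ L y) * μ K ≤ ((Λ ∩ x • (K * L)).encard : ℝ≥0∞) := by
  have hsub (y : G) (hy : y ∈ x • K) : y • L ⊆ x • (K * L) := by
    rw [← smul_mul_assoc]
    exact Set.smul_set_subset_mul hy
  refine (ENNReal.mul_le_mul_iff_left hL_zero hL.measure_ne_top).1 ?_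
  calc (⨅ y : G, countRatio μ Λ L y) * μ K * μ L
      = ∫⁻ _ in x • K, (⨅ y : G, countRatio μ Λ L y) * μ L ∂μ := by
        rw [setLIntegral_const, measure_smul, mul_right_comm]
    _ ≤ ∫⁻ y in x • K, ((Λ ∩ x • (K * L) ∩ y • L⁻¹⁻¹).encard : ℝ≥0∞) ∂μ := by
        refine setLIntegral_mono' (hK.smul x).measurableSet fun y hy => ?_
        rw [inv_inv, Set.inter_assoc, Set.inter_eq_right.2 (hsub y hy),
          ← countRatio_mul_measure Λ hL_zero hL.measure_ne_top]
        gcongr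
        exact iInf_le _ y
    _ ≤ ((Λ ∩ x • (K * L)).encard : ℝ≥0∞) * μ L⁻¹ := by
        rw [encard_inter_mul_measure hΛ hL.inv.measurableSet]
        exact setLIntegral_le_lintegral _ _
    _ = _ := by rw [Measure.measure_inv]

lemma IsRelativelySeparated.hasLowerBeurlingDensity [T2Space G] [LocallyCompactSpace G]
    [μ.IsHaarMeasure] [μ.IsInvInvariant] {Λ : Set G} (hsep : IsRelativelySeparated Λ)
    (hΛ : Λ.Countable) : HasLowerBeurlingDensity μ Λ (lowerDensity μ Λ) := by
  obtain ⟨P, hP, -, κ, hκ, hκ_le⟩ := hsep.exists_encard_inter_le μ hΛ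
  intro K hK
  refine tendsto_order.2 ⟨fun b hb => ?_, fun b hb => .of_forall fun n =>
    (iInf_countRatio_le_lowerDensity Λ (hK.isCompact n) (hK.measure_ne_zero n)).trans_lt hb⟩
  simp only [lowerDensity, lt_iSup_iff] at hb
  obtain ⟨L, hL, hL_zero, hb⟩ := hb
  set D := ⨅ x : G, countRatio μ Λ L x
  set boundary := fun n => μ ((K n * (L * P ∪ P)) ∩ ((K n)ᶜ * (L * P ∪ P))) / μ (K n)
  have hle (n : ℕ) : D ≤ (⨅ x : G, countRatio μ Λ (K n) x) + κ * boundary n := by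
    rw [ENNReal.iInf_add]
    refine le_iInf fun x => ?_
    rw [countRatio, ← mul_div_assoc, ← ENNReal.add_div, ENNReal.le_div_iff_mul_le
      (.inl (hK.measure_ne_zero n)) (.inl (hK.isCompact n).measure_ne_top)]
    exact (iInf_countRatio_mul_measure_le hΛ (hK.isCompact n) hL hL_zero x).trans
      (encard_inter_smul_mul_le hκ_le _ _ x)
  have hlim := ENNReal.Tendsto.const_mul (a := κ)
    (hK.tendsto_boundary _ ((hL.mul hP).union hP)) (.inr hκ)
  rw [mul_zero] at hlim
  filter_upwards [hlim.eventually (gt_mem_nhds (tsub_pos_of_lt hb))] with n hn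
  by_contra! hn_le
  have : D ≤ b + κ * boundary n := (hle n).trans (add_le_add_left hn_le _)
  exact (tsub_le_iff_left.2 this).not_gt hn

end Density

section CoherentSystems

variable {G : Type*} [Group G] [MeasurableSpace G]
variable {H : Type*} [NormedAddCommGroup H] [InnerProductSpace ℂ H]
variable {π : G → H ≃ₗᵢ[ℂ] H} {g : H}

omit [Group G] [MeasurableSpace G] in
lemma IsFrame.ne_zero [Nontrivial H] {Λ : Set G} (h : IsFrame (coherentSystem π Λ g)) : g ≠ 0 := by
  rintro rfl
  obtain ⟨A, _, hA, -, hA_le⟩ := h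
  obtain ⟨f, hf⟩ := exists_ne (0 : H)
  have hle := (hA_le f).2.1
  simp only [coherentSystem, map_zero, inner_zero_left, norm_zero, zero_pow two_ne_zero,
    tsum_zero] at hle
  exact hle.not_gt (by positivity)

lemma IsProjectiveRep.enorm_inner_apply_apply (hπ : IsProjectiveRep π) (g f : H) (x y : G) :
    ‖inner ℂ (π x g) (π y f)‖ₑ = ‖coeff π g f (y⁻¹ * x)‖ₑ := by
  rw [enorm_eq_iff_norm_eq, ← hπ.norm_coeff_apply, coeff]

lemma enorm_sq_eq_add_enorm_sub_starProjection_sq (W : Submodule ℂ H) [W.HasOrthogonalProjection]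
    (u : H) : ‖u‖ₑ ^ 2 = ‖W.starProjection u‖ₑ ^ 2 + ‖u - W.starProjection u‖ₑ ^ 2 := by
  simp only [← ofReal_norm_sq]
  rw [← ENNReal.ofReal_add (sq_nonneg _) (sq_nonneg _), W.norm_sq_eq_add_norm_sq_starProjection,
    W.starProjection_orthogonal_val]

lemma mul_enorm_sq_le_enorm_starProjection_sq {W : Submodule ℂ H} [W.HasOrthogonalProjection]
    {u : H} {θ : ℝ≥0∞} (hθ : θ ≤ 1)
    (h : ‖u - W.starProjection u‖ₑ ^ 2 ≤ (1 - θ) * ‖u‖ₑ ^ 2) :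
    θ * ‖u‖ₑ ^ 2 ≤ ‖W.starProjection u‖ₑ ^ 2 := by
  refine (ENNReal.add_le_add_iff_right (a := (1 - θ) * ‖u‖ₑ ^ 2) (by finiteness)).1 ?_
  calc θ * ‖u‖ₑ ^ 2 + (1 - θ) * ‖u‖ₑ ^ 2 = ‖u‖ₑ ^ 2 := by
        rw [← add_mul, add_tsub_cancel_of_le hθ, one_mul]
    _ = ‖W.starProjection u‖ₑ ^ 2 + ‖u - W.starProjection u‖ₑ ^ 2 :=
        enorm_sq_eq_add_enorm_sub_starProjection_sq W u
    _ ≤ _ := by grw [h]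

lemma IsProjectiveRep.setLIntegral_compl_smul_enorm_inner_sq [MeasurableMul G] {μ : Measure G}
    [μ.IsMulLeftInvariant] (hπ : IsProjectiveRep π) (g f : H) (x : G) (C : Set G) :
    ∫⁻ y in (x • C)ᶜ, ‖inner ℂ (π x f) (π y g)‖ₑ ^ 2 ∂μ =
      ∫⁻ y in Cᶜ, ‖coeff π g f y‖ₑ ^ 2 ∂μ := by
  have hinner (y : G) : ‖inner ℂ (π x f) (π y g)‖ₑ = ‖coeff π g f (x⁻¹ * y)‖ₑ := by
    rw [← hπ.enorm_inner_apply_apply, enorm_eq_iff_norm_eq, norm_inner_symm]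
  simp only [hinner, ← Set.preimage_smul_inv, smul_eq_mul]
  exact (measurePreserving_mul_left μ x⁻¹).setLIntegral_comp_preimage_emb
    (measurableEmbedding_mulLeft x⁻¹) (fun y => ‖coeff π g f y‖ₑ ^ 2) Cᶜ

lemma IsProjectiveRep.setLIntegral_compl_sum_enorm_inner_sq_le [MeasurableMul G] {μ : Measure G}
    [μ.IsMulLeftInvariant] (hπ : IsProjectiveRep π) (g f : H) {ι : Type*} {F : Finset ι}
    {p : ι → G} {C S : Set G} (h : ∀ i ∈ F, p i • C ⊆ S) :
    ∫⁻ y in Sᶜ, ∑ i ∈ F, ‖inner ℂ (π (p i) f) (π y g)‖ₑ ^ 2 ∂μ ≤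
      F.card * ∫⁻ y in Cᶜ, ‖coeff π g f y‖ₑ ^ 2 ∂μ := by
  have hmeas (i : ι) : Measurable fun y => ‖inner ℂ (π (p i) f) (π y g)‖ₑ ^ 2 :=
    (stronglyMeasurable_const.inner (hπ.stronglyMeasurable g)).enorm.pow_const 2
  rw [lintegral_finsetSum F fun i _ => hmeas i, ← nsmul_eq_mul]
  refine Finset.sum_le_card_nsmul F _ _ fun i hi => ?_
  rw [← hπ.setLIntegral_compl_smul_enorm_inner_sq g f (p i)]
  exact lintegral_mono_set (Set.compl_subset_compl.2 (h i hi))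

lemma exists_finset_mem_iff {α : Type*} {s t : Set α} (h : (s ∩ t).Finite) :
    ∃ F : Finset s, (∀ a, a ∈ F ↔ (a : α) ∈ t) ∧ (F.card : ℝ≥0∞) = ((s ∩ t).encard : ℝ≥0∞) := by
  have himage : ((↑) : s → α) '' ((↑) ⁻¹' t) = s ∩ t := Subtype.image_preimage_coe s t
  have hfinite : ((↑) ⁻¹' t : Set s).Finite :=
    (himage ▸ h).of_finite_image Subtype.val_injective.injOn
  refine ⟨hfinite.toFinset, fun a => hfinite.mem_toFinset, ?_⟩
  rw [← himage, Subtype.val_injective.encard_image, hfinite.encard_eq_coe_toFinset_card,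
    ENat.toENNReal_coe]

section Dimension

variable {μ : Measure G} {d : ℝ} {W : Submodule ℂ H} [FiniteDimensional ℂ W] {S : Set G}

lemma IsFormalDegree.mul_measure_le_finrank (hd : IsFormalDegree μ π d) (hπ : IsProjectiveRep π)
    (hg : g ≠ 0) (hS : MeasurableSet S) {θ : ℝ≥0∞}
    (h : ∀ y ∈ S, θ * ‖g‖ₑ ^ 2 ≤ ‖W.starProjection (π y g)‖ₑ ^ 2) :
    θ * ENNReal.ofReal d * μ S ≤ Module.finrank ℂ W := by
  have hd_zero : ENNReal.ofReal d ≠ 0 := by simpa using hd.1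
  have hg_zero : ‖g‖ₑ ^ 2 ≠ 0 := by simpa using hg
  have hg_top : ‖g‖ₑ ^ 2 ≠ ∞ := by finiteness
  have hle : θ * μ S * ‖g‖ₑ ^ 2 ≤ Module.finrank ℂ W / ENNReal.ofReal d * ‖g‖ₑ ^ 2 :=
    calc θ * μ S * ‖g‖ₑ ^ 2 = ∫⁻ _ in S, θ * ‖g‖ₑ ^ 2 ∂μ := by rw [setLIntegral_const]; ring
      _ ≤ ∫⁻ y in S, ‖W.starProjection (π y g)‖ₑ ^ 2 ∂μ := setLIntegral_mono' hS h
      _ ≤ ∫⁻ y, ‖W.starProjection (π y g)‖ₑ ^ 2 ∂μ := setLIntegral_le_lintegral _ _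
      _ = _ := by rw [hd.lintegral_enorm_starProjection_sq hπ, div_eq_mul_inv, mul_assoc]
  rw [mul_right_comm, ← ENNReal.le_div_iff_mul_le (.inl hd_zero) (.inl ENNReal.ofReal_ne_top)]
  exact (ENNReal.mul_le_mul_iff_left hg_zero hg_top).1 hle

lemma IsFormalDegree.mul_finrank_le (hd : IsFormalDegree μ π d) (hπ : IsProjectiveRep π)
    (hg : g ≠ 0) (hS : MeasurableSet S) {θ : ℝ≥0∞} (hθ : θ < 1)
    (h : ∫⁻ y in Sᶜ, ‖W.starProjection (π y g)‖ₑ ^ 2 ∂μ ≤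
      Module.finrank ℂ W * ((1 - θ) * ((ENNReal.ofReal d)⁻¹ * ‖g‖ₑ ^ 2))) :
    θ * Module.finrank ℂ W ≤ ENNReal.ofReal d * μ S := by
  have hd_zero : ENNReal.ofReal d ≠ 0 := by simpa using hd.1
  have hg_zero : ‖g‖ₑ ^ 2 ≠ 0 := by simpa using hg
  have hg_top : ‖g‖ₑ ^ 2 ≠ ∞ := by finiteness
  set c := (ENNReal.ofReal d)⁻¹ * ‖g‖ₑ ^ 2
  have hc_top : c ≠ ∞ := by finiteness
  have hinside : ∫⁻ y in S, ‖W.starProjection (π y g)‖ₑ ^ 2 ∂μ ≤ ‖g‖ₑ ^ 2 * μ S := by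
    rw [← setLIntegral_const]
    gcongr with y
    simpa [enorm_le_iff_norm_le] using W.norm_starProjection_apply_le (π y g)
  have htrace : θ * Module.finrank ℂ W * c + Module.finrank ℂ W * ((1 - θ) * c) ≤
      ‖g‖ₑ ^ 2 * μ S + Module.finrank ℂ W * ((1 - θ) * c) :=
    calc θ * Module.finrank ℂ W * c + Module.finrank ℂ W * ((1 - θ) * c)
        = (θ + (1 - θ)) * (Module.finrank ℂ W * c) := by ring
      _ = ∫⁻ y, ‖W.starProjection (π y g)‖ₑ ^ 2 ∂μ := by
        rw [add_tsub_cancel_of_le hθ.le, one_mul, hd.lintegral_enorm_starProjection_sq hπ]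
      _ ≤ _ := by
        rw [← lintegral_add_compl _ hS]
        exact add_le_add hinside h
  have hle : θ * Module.finrank ℂ W * c ≤ ‖g‖ₑ ^ 2 * μ S :=
    (ENNReal.add_le_add_iff_right (by finiteness)).1 htrace
  refine (ENNReal.mul_le_mul_iff_left hg_zero hg_top).1 ?_
  calc θ * Module.finrank ℂ W * ‖g‖ₑ ^ 2
      = ENNReal.ofReal d * (θ * Module.finrank ℂ W * c) := by
        rw [mul_left_comm _ _ c, ← mul_assoc (ENNReal.ofReal d), ENNReal.mul_inv_cancel hd_zero
          ENNReal.ofReal_ne_top, one_mul]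
    _ ≤ ENNReal.ofReal d * (‖g‖ₑ ^ 2 * μ S) := by gcongr
    _ = _ := by ring

end Dimension

variable [TopologicalSpace G] [IsTopologicalGroup G] [LocallyCompactSpace G]
  [SecondCountableTopology G] [BorelSpace G] {Λ : Set G}

/- Near the identity `⟨g, π(x) g⟩` stays away from zero, so a cluster of points of `Λ` around `x`
violates the Bessel inequality for the vector `π x g`. -/
lemma IsFrame.isRelativelySeparated (hπ : IsProjectiveRep π) (hg : g ≠ 0)
    (h : IsFrame (coherentSystem π Λ g)) : IsRelativelySeparated Λ := by
  obtain ⟨B, hB, hB_le⟩ := h.exists_tsum_enorm_inner_sq_le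
  obtain ⟨c, hc, hcg⟩ : ∃ c : ℝ, 0 < c ∧ c < ‖coeff π g g 1‖ := by
    refine exists_between ?_
    rw [hπ.norm_coeff_one, norm_pos_iff]
    exact inner_self_ne_zero.2 hg
  refine ⟨{x | c < ‖coeff π g g x‖}, 
    (hπ.continuous_norm_coeff g g).continuousAt.eventually_const_lt hcg,
    B * ‖g‖ₑ ^ 2 / ENNReal.ofReal c ^ 2, ?_, fun x => ?_⟩
  · have : ENNReal.ofReal c ^ 2 ≠ 0 := by simpa using hc
    finiteness
  rw [ENNReal.le_div_iff_mul_le (by simp [hc]) (by simp)]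
  calc ((Λ ∩ x • {x | c < ‖coeff π g g x‖}).encard : ℝ≥0∞) * ENNReal.ofReal c ^ 2
      = ∑' _ : ↥(Λ ∩ x • {x | c < ‖coeff π g g x‖}), ENNReal.ofReal c ^ 2 :=
        (ENNReal.tsum_set_const _ _).symm
    _ ≤ ∑' l : ↥(Λ ∩ x • {x | c < ‖coeff π g g x‖}), ‖inner ℂ (π l g) (π x g)‖ₑ ^ 2 := by
        refine ENNReal.tsum_le_tsum fun l => ?_
        rw [hπ.enorm_inner_apply_apply, ← ofReal_norm]
        gcongr
        exact (Set.mem_smul_set_iff_inv_smul_mem.1 l.2.2).le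
    _ ≤ ∑' l : Λ, ‖inner ℂ (π l g) (π x g)‖ₑ ^ 2 :=
        ENNReal.tsum_mono_subtype (fun l => ‖inner ℂ (π l g) (π x g)‖ₑ ^ 2) Set.inter_subset_left
    _ ≤ B * ‖g‖ₑ ^ 2 := by
        simpa only [coherentSystem, LinearIsometryEquiv.enorm_map] using hB_le (π x g)

omit [SecondCountableTopology G] in
lemma IsRelativelySeparated.finite_inter (hsep : IsRelativelySeparated Λ) (hΛ : Λ.Countable)
    {S : Set G} (hS : IsCompact S) : (Λ ∩ S).Finite := by
  obtain ⟨P, hP, -, κ, hκ, hκ_le⟩ := hsep.exists_encard_inter_le Measure.haar hΛ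
  have : ((Λ ∩ S).encard : ℝ≥0∞) < ∞ :=
    (hκ_le S).trans_lt (ENNReal.mul_lt_top hκ.lt_top (hS.mul hP).measure_lt_top)
  simpa using this

variable [T2Space G] [CompleteSpace H] {μ : Measure G} [μ.IsHaarMeasure] {d : ℝ}

/- The vectors `π y g` with `y ∈ x • K` are almost contained in a space of dimension at most
`#(Λ ∩ x • (K * C))`. -/
lemma IsFrame.exists_isCompact_mul_measure_le (hπ : IsProjectiveRep π)
    (hd : IsFormalDegree μ π d) {Q : Set G} (hQ : Q ∈ 𝓝 1) (hgB : g ∈ B2 μ Q π) (hg : g ≠ 0)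
    (hΛ : Λ.Countable) (h : IsFrame (coherentSystem π Λ g)) {θ : ℝ≥0∞} (hθ : θ < 1) :
    ∃ C : Set G, IsCompact C ∧ 1 ∈ C ∧ ∀ K : Set G, IsCompact K → ∀ x : G,
      θ * ENNReal.ofReal d * μ K ≤ ((Λ ∩ x • (K * C)).encard : ℝ≥0∞) := by
  have hsep := h.isRelativelySeparated hπ hg
  obtain ⟨B, hB, hW⟩ := h.exists_submodule_enorm_sub_starProjection_sq_le
  set ε := (1 - θ) * ‖g‖ₑ ^ 2 / B
  have hε : ε ≠ 0 := ENNReal.div_ne_zero.2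
    ⟨mul_ne_zero (tsub_pos_of_lt hθ).ne' (by simpa using hg), hB⟩
  obtain ⟨C, hC, hC_one, htail⟩ :=
    hgB.exists_tsum_enorm_sq_le (hπ.continuous_norm_coeff g g) hQ hΛ hsep hε
  refine ⟨C, hC, hC_one, fun K hK x => ?_⟩
  obtain ⟨F, hF, hF_card⟩ := exists_finset_mem_iff (hsep.finite_inter hΛ ((hK.mul hC).smul x))
  obtain ⟨W, _, hW_finrank, hW_le⟩ := hW F
  have hdist (y : G) (hy : y ∈ x • K) :
      ‖π y g - W.starProjection (π y g)‖ₑ ^ 2 ≤ (1 - θ) * ‖g‖ₑ ^ 2 := by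
    have hsub : {l : Λ | l ∉ F} ⊆ {l : Λ | (l : G) ∉ y • C} := fun l hl hly => hl <| (hF l).2 <| by
      rw [← smul_mul_assoc]
      exact Set.smul_set_subset_mul hy hly
    calc _ ≤ B * ∑' l : {l // l ∉ F}, ‖inner ℂ (coherentSystem π Λ g l) (π y g)‖ₑ ^ 2 := hW_le _
      _ ≤ B * ∑' l : {l : Λ // (l : G) ∉ y • C}, ‖coeff π g g (y⁻¹ * l)‖ₑ ^ 2 := by
        simp only [coherentSystem, hπ.enorm_inner_apply_apply]
        gcongr B * ?_
        exact ENNReal.tsum_mono_subtype (fun l : Λ => ‖coeff π g g (y⁻¹ * l)‖ₑ ^ 2) hsub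
      _ ≤ B * ε := by grw [htail y]
      _ ≤ _ := ENNReal.mul_div_le
  have hproj (y : G) (hy : y ∈ x • K) : θ * ‖g‖ₑ ^ 2 ≤ ‖W.starProjection (π y g)‖ₑ ^ 2 := by
    rw [← LinearIsometryEquiv.enorm_map (π y) g] at hdist ⊢
    exact mul_enorm_sq_le_enorm_starProjection_sq hθ.le (hdist y hy)
  calc θ * ENNReal.ofReal d * μ K = θ * ENNReal.ofReal d * μ (x • K) := by rw [measure_smul]
    _ ≤ Module.finrank ℂ W := hd.mul_measure_le_finrank hπ hg (hK.smul x).measurableSet hproj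
    _ ≤ F.card := by exact_mod_cast hW_finrank
    _ = _ := hF_card

/- A space of dimension `#(Λ ∩ x • K)` is almost orthogonal to the vectors `π y g` with
`y ∉ x • (K * C)`. -/
lemma IsRieszBasis.exists_isCompact_mul_encard_le (hπ : IsProjectiveRep π)
    (hd : IsFormalDegree μ π d) (hg : g ≠ 0)
    (hΛ : Λ.Countable) (h : IsRieszBasis (coherentSystem π Λ g)) {θ : ℝ≥0∞} (hθ : θ < 1) :
    ∃ C : Set G, IsCompact C ∧ 1 ∈ C ∧ ∀ K : Set G, IsCompact K → ∀ x : G,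
      θ * ((Λ ∩ x • K).encard : ℝ≥0∞) ≤ ENNReal.ofReal d * μ (K * C) := by
  have hsep := h.1.isRelativelySeparated hπ hg
  obtain ⟨B, hB, hW⟩ := h.exists_submodule_enorm_starProjection_sq_le
  set ε := (1 - θ) * ((ENNReal.ofReal d)⁻¹ * ‖g‖ₑ ^ 2) / B
  have hε : ε ≠ 0 := ENNReal.div_ne_zero.2
    ⟨mul_ne_zero (tsub_pos_of_lt hθ).ne' (by simpa using hg), hB⟩
  have hint : ∫⁻ x, ‖coeff π g g x‖ₑ ^ 2 ∂μ ≠ ∞ := by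
    have hd_zero : ENNReal.ofReal d ≠ 0 := by simpa using hd.1
    rw [hd.lintegral_enorm_coeff_sq]
    finiteness
  obtain ⟨C, hC, htail⟩ := exists_isCompact_setLIntegral_compl_le hint hε
  refine ⟨insert 1 C, hC.insert 1, Set.mem_insert _ _, fun K hK x => ?_⟩
  obtain ⟨F, hF, hF_card⟩ := exists_finset_mem_iff (hsep.finite_inter hΛ (hK.smul x))
  obtain ⟨W, _, hW_finrank, hW_le⟩ := hW F
  set S := x • (K * insert 1 C)
  have hS : MeasurableSet S := ((hK.mul (hC.insert 1)).smul x).measurableSet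
  have hsub (l : Λ) (hl : l ∈ F) : (l : G) • C ⊆ S :=
    (Set.smul_set_mono (Set.subset_insert 1 C)).trans <|
      (Set.smul_set_subset_mul ((hF l).1 hl)).trans_eq (smul_mul_assoc _ _ _)
  have houtside : ∫⁻ y in Sᶜ, ‖W.starProjection (π y g)‖ₑ ^ 2 ∂μ ≤
      Module.finrank ℂ W * ((1 - θ) * ((ENNReal.ofReal d)⁻¹ * ‖g‖ₑ ^ 2)) :=
    calc _ ≤ ∫⁻ y in Sᶜ, B * ∑ l ∈ F, ‖inner ℂ (π l g) (π y g)‖ₑ ^ 2 ∂μ :=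
          lintegral_mono fun y => hW_le (π y g)
      _ ≤ B * (F.card * ε) := by
        rw [lintegral_const_mul' _ _ hB]
        grw [hπ.setLIntegral_compl_sum_enorm_inner_sq_le g g hsub, htail]
      _ ≤ _ := by
        rw [hW_finrank, mul_left_comm]
        exact mul_le_mul_right ENNReal.mul_div_le _
  rw [← hF_card, ← hW_finrank, ← measure_smul μ x]
  exact hd.mul_finrank_le hπ hg hS hθ houtside

lemma IsFrame.exists_hasLowerBeurlingDensity [μ.IsInvInvariant] (hG : IsAmenable μ)
    (hπ : IsProjectiveRep π) (hd : IsFormalDegree μ π d) {Q : Set G} (hQ : Q ∈ 𝓝 1)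
    (hgB : g ∈ B2 μ Q π) (hg : g ≠ 0) (hΛ : Λ.Countable) (h : IsFrame (coherentSystem π Λ g)) :
    ∃ D, HasLowerBeurlingDensity μ Λ D ∧ ENNReal.ofReal d ≤ D :=
  ⟨lowerDensity μ Λ, (h.isRelativelySeparated hπ hg).hasLowerBeurlingDensity hΛ,
    le_lowerDensity hG fun _ hθ => h.exists_isCompact_mul_measure_le hπ hd hQ hgB hg hΛ hθ⟩

end CoherentSystems

end CoherentFrames

theorem corollary3p4
    {G : Type*} [Group G] [TopologicalSpace G] [IsTopologicalGroup G] [T2Space G]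
    [LocallyCompactSpace G] [SecondCountableTopology G] [MeasurableSpace G] [BorelSpace G]
    (μ : Measure G) [μ.IsHaarMeasure] [μ.IsMulRightInvariant]
    (hG : CoherentFrames.IsAmenable μ)
    (Q : Set G) (hQ_compact : IsCompact Q) (hQ_symm : Q⁻¹ = Q) (hQ_nhds : Q ∈ 𝓝 (1 : G))
    {H : Type*} [NormedAddCommGroup H] [InnerProductSpace ℂ H] [CompleteSpace H]
    (π : G → H ≃ₗᵢ[ℂ] H) (hπ : CoherentFrames.IsDiscreteSeries μ π) :
    ∃ d : ℝ, CoherentFrames.IsFormalDegree μ π d ∧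
      ∀ Λ : Set G, DiscreteTopology Λ → ∀ g ∈ CoherentFrames.B2 μ Q π,
        (CoherentFrames.IsFrame (CoherentFrames.coherentSystem π Λ g) →
          ∃ D : ℝ≥0∞, CoherentFrames.HasLowerBeurlingDensity μ Λ D ∧ ENNReal.ofReal d ≤ D) ∧
        (CoherentFrames.IsRieszBasis (CoherentFrames.coherentSystem π Λ g) →
          CoherentFrames.HasUpperBeurlingDensity μ Λ (ENNReal.ofReal d)) := by
  have := CoherentFrames.isInvInvariant_of_isMulRightInvariant μ
  have hrep := hπ.toIsProjectiveRep
  obtain ⟨f, hf, -⟩ := hπ.squareIntegrable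
  have : Nontrivial H := ⟨f, 0, hf⟩
  obtain ⟨d, hd⟩ := hπ.exists_isFormalDegree
  refine ⟨d, hd, fun Λ hΛ g hgB => ?_⟩
  have hΛ_countable : Λ.Countable :=
    Set.countable_coe_iff.1 (TopologicalSpace.separableSpace_iff_countable.1 inferInstance)
  have hlower (h : CoherentFrames.IsFrame (CoherentFrames.coherentSystem π Λ g)) :=
    h.exists_hasLowerBeurlingDensity hG hrep hd hQ_nhds hgB h.ne_zero hΛ_countable
  refine ⟨hlower, fun h => ?_⟩
  obtain ⟨D, hD, hdD⟩ := hlower h.1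
  exact hD.hasUpperBeurlingDensity hdD fun θ hθ =>
    h.exists_isCompact_mul_encard_le hrep hd h.1.ne_zero hΛ_countable hθ
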